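/- **Notation.** For integers $n,m\ge 0$ let $[n;m]=\{1,2,\dots,n,n+2,n+4,\dots,n+2m\}$. For $I\subseteq[n;m]$ put $$\mathbf d_{n,m}(I)=\prod_{i\in I,\ j\in[n;m]\setminus I}\left|\frac{i+j}{i-j}\right|,\qquad \mathbf c(I)=\sum_{i\in I,\ i>n}\frac{i-n}{2},\qquad |I|=\sum_{i\in I}i .$$ For $a\in\mathbb C$ and $i\ge 1$ let $a_i=\prod_{1\le j\le i,\ j\equiv i\ (2)}\bigl(a+(j-1)^2\bigr)$ and $a_I=\prod_{i\in I}a_i$, and similarly for $b$. Set $$U_{n,m}(z,w;a,b)=\sum_{I\subseteq[n;m]}\mathbf d_{n,m}(I)\,(-1)^{\mathbf c(I)}\,a_I\,b_{[n;m]\setminus I}\,z^{|I|}\,w^{|[n;m]\setminus I|}.$$ Let $\Omega\subseteq\mathbb C\setminus\{0,1\}$ be open, and fix on $\Omega$ holomorphic branches of $\sqrt t$, $\sqrt{t-1}$, $z=\tfrac12(v-2)^{1/2}$ and $w=\tfrac12(v+2)^{1/2}$, where $v=\frac{\sqrt t}{\sqrt{t-1}}+\frac{\sqrt{t-1}}{\sqrt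 t}$. For $b_1,b_2\in\mathbb C$ let $U_{n,m}(b_1,b_2)=U_{n,m}(z,w;-4b_1^2,-4b_2^2)$, regarded as a function of $t\in\Omega$, and $$h_0=\tfrac14\left\{b_1^2\bigl(\sqrt t-\sqrt{t-1}\bigr)^2+b_2^2\bigl(\sqrt t+\sqrt{t-1}\bigr)^2\right\},\qquad h_{n,m}(b_1,b_2)=t(t-1)\frac{d}{dt}\log U_{n,m}(b_1,b_2)-h_0 .$$ For $b_1,b_2,b_3,b_4\in\mathbb C$, the Painlevé–Okamoto equation $E_{VI}(b_1,b_2,b_3,b_4)$ is $$\frac{dh}{dt}\left[t(t-1)\frac{d^2h}{dt^2}\right]^2+\left[\frac{dh}{dt}\left\{2h-(2t-1)\frac{dh}{dt}\right\}+b_1b_2b_3b_4\right]^2=\prod_{k=1}^4\left(\frac{dh}{dt}+b_k^2\right).$$ **Proposition 4.** Let $n,m\ge 0$ be integers. (i) For all $b_1,b_2\in\mathbb C$, the function $h_{0,m}(b_1,b_2)$ is holomorphic and satisfies $E_{VI}(b_1,b_2,m+\tfrac12,0)$ on the open set $\{t\in\Omega: U_{0,m}(b_1,b_2)(t)\ne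 0\}$. (ii) $U_{1,m}(0,m+1)$ has no zero in $\Omega$, $h_{1,m}(0,m+1)=-(2t-1)(m+1)^2/2$ on $\Omega$, and this function satisfies $E_{VI}(0,m+1,b_3,b_4)$ on $\Omega$ for all $b_3,b_4\in\mathbb C$. (iii) For every $b_2\in\mathbb C$, the function $h_{n,m}(0,b_2)$ is holomorphic and satisfies $E_{VI}\bigl(0,b_2,\tfrac n2,\tfrac{n+2m+1}{2}\bigr)$ on the open set $\{t\in\Omega: U_{n,m}(0,b_2)(t)\ne 0\}$. -/

import Mathlib

noncomputable section

namespace GenUmemura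

/-- The index set `[n;m] = {1, 2, …, n, n+2, n+4, …, n+2m}`. -/
def indexSet (n m : ℕ) : Finset ℕ :=
  Finset.Icc 1 n ∪ (Finset.Icc 1 m).image (fun j => n + 2 * j)

/-- The number `d_{n,m}(I) = ∏_{i ∈ I, j ∈ [n;m] \ I} |(i+j)/(i-j)|`. -/
def dNum (n m : ℕ) (I : Finset ℕ) : ℚ :=
  ∏ i ∈ I, ∏ j ∈ indexSet n m \ I, |((i : ℚ) + j) / ((i : ℚ) - j)|

/-- The exponent `c(I) = ∑_{i ∈ I, i > n} (i-n)/2`; for `I ⊆ [n;m]` every division is exact. -/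
def cNum (n : ℕ) (I : Finset ℕ) : ℕ :=
  ∑ i ∈ I with n < i, (i - n) / 2

/-- `a_i = ∏ ā_j` over `1 ≤ j ≤ i` with `j ≡ i (mod 2)`, where `ā_j = a + (j-1)²`. -/
def parityProd (a : ℂ) (i : ℕ) : ℂ :=
  ∏ j ∈ Finset.Icc 1 i with j % 2 = i % 2, (a + ((j : ℂ) - 1) ^ 2)

/-- The polynomial `U_{n,m}(z,w;a,b)` (the case `k = 0` of the generalized Umemura
polynomials).  The exponents of `z` and `w` are the sums of the elements of `I` and of
its complement in `[n;m]`. -/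
def umemura (n m : ℕ) (z w a b : ℂ) : ℂ :=
  ∑ I ∈ (indexSet n m).powerset,
    (dNum n m I : ℂ) * (-1) ^ cNum n I *
      ((∏ i ∈ I, parityProd a i) * (∏ i ∈ indexSet n m \ I, parityProd b i) *
        z ^ (∑ i ∈ I, i) * w ^ (∑ i ∈ indexSet n m \ I, i))

/-- On the open set `Ω ⊆ ℂ \ {0, 1}`, the functions `r` and `s` are holomorphic branches of
`√t` and `√(t-1)`, and, with `v = √(t/(t-1)) + √((t-1)/t)`, the functions `z` and `w` are
holomorphic branches of `½ (v - 2)^{1/2}` and `½ (v + 2)^{1/2}`. -/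
structure AreBranches (Ω : Set ℂ) (r s z w : ℂ → ℂ) : Prop where
  isOpen : IsOpen Ω
  zero_notMem : (0 : ℂ) ∉ Ω
  one_notMem : (1 : ℂ) ∉ Ω
  r_holo : DifferentiableOn ℂ r Ω
  s_holo : DifferentiableOn ℂ s Ω
  z_holo : DifferentiableOn ℂ z Ω
  w_holo : DifferentiableOn ℂ w Ω
  r_sq : ∀ t ∈ Ω, r t ^ 2 = t
  s_sq : ∀ t ∈ Ω, s t ^ 2 = t - 1
  z_sq : ∀ t ∈ Ω, (2 * z t) ^ 2 = r t / s t + s t / r t - 2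
  w_sq : ∀ t ∈ Ω, (2 * w t) ^ 2 = r t / s t + s t / r t + 2

/-- `U_{n,m}(b₁,b₂) = U_{n,m}(z,w;-4b₁²,-4b₂²)` as a function of `t`. -/
def umemuraFun (z w : ℂ → ℂ) (n m : ℕ) (b₁ b₂ : ℂ) (t : ℂ) : ℂ :=
  umemura n m (z t) (w t) (-4 * b₁ ^ 2) (-4 * b₂ ^ 2)

/-- `h₀ = {b₁² (√t - √(t-1))² + b₂² (√t + √(t-1))²} / 4`. -/
def hZero (r s : ℂ → ℂ) (b₁ b₂ : ℂ) (t : ℂ) : ℂ :=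
  (b₁ ^ 2 * (r t - s t) ^ 2 + b₂ ^ 2 * (r t + s t) ^ 2) / 4

/-- `h_{n,m}(b₁,b₂) = t(t-1) (log U_{n,m}(b₁,b₂))' - h₀`. -/
def hFun (r s z w : ℂ → ℂ) (n m : ℕ) (b₁ b₂ : ℂ) (t : ℂ) : ℂ :=
  t * (t - 1) * logDeriv (umemuraFun z w n m b₁ b₂) t - hZero r s b₁ b₂ t

/-- `h` is a holomorphic solution on the open set `Ω` of the Painlevé–Okamoto equation
`E_VI(b)`, `b = (b 0, b 1, b 2, b 3)`. -/
def SolvesEVI (b : Fin 4 → ℂ) (h : ℂ → ℂ) (Ω : Set ℂ) : Prop :=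
  IsOpen Ω ∧ DifferentiableOn ℂ h Ω ∧ ∀ t ∈ Ω,
    deriv h t * (t * (t - 1) * deriv (deriv h) t) ^ 2
      + (deriv h t * (2 * h t - (2 * t - 1) * deriv h t) + ∏ k, b k) ^ 2
      = ∏ k, (deriv h t + b k ^ 2)

end GenUmemura

end

/-! Put `Z = z²`, so that `w² = Z + 1`. For `n = 0` the polynomial `U_{0,m}` depends only on `Z`: it
is a KdV `m`-soliton tau function (`solitonPoly`), up to a constant the `m`-th leading minor of a
matrix with Wronskian-type columns (`leadingMinor_solitonEntry`). With `D = Z(Z+1) d/dZ`, a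
Darboux–Crum argument (`leadingMinor_schrodinger`) gives a linear second-order equation for
`U_{m+1}/U_m` whose potential comes from `u = D log U_m`.

The identity to be proved is a cubic relation between `P` (essentially `h`), `X = 4 dh/dt` and `DX`.
It follows by eliminating `q = D log (U_{m-1}/U_m)` from the relations in `TauPair`
(`TauPair.cubic`). These relations are carried from `m` to `m + 1` by `TauPair.next`, provided that
`U_{m-1} U_{m+1} = (X + (2m+1)²) U_m²`. This Toda equation (`toda_equation`) is a uniqueness
statement: after division by `U_{m-1} U_m` both sides solve the same linear equation, they agree at
the singular points `Z = 0, -1`, and the exponents there force equality. The argument needs `U_m`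
nonzero at `0` and `-1`, which holds for generic parameters; density and continuity of coefficients
give all parameters (`umemuraPoly_cubic`). Since `t(t-1) d/dt = -2√(t(t-1)) D`, the cubic relation
becomes `E_VI` with one parameter zero.

For `b₁ = 0` and general `n`, every `I` containing an odd number contributes `0`. What the odd
numbers in the complement contribute turns `a = 0` into `a = -4M²` and leaves a factor `c w^{M²}`
(`umemura_even`, `umemura_odd`). This factor changes the logarithmic derivative by exactly the
difference of the two `h₀`, so `h_{n,m}(0,b₂) = h_{0,μ}(M,b₂)`, and (iii) reduces to the case `n =
0`; in (ii) the remaining polynomial is `1`. -/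

noncomputable section

open Polynomial

/-! ### Derivations: extension to the fraction field and Jacobi's formula. -/

/-- The extension of a derivation of an integral domain to its field of fractions. -/
theorem Derivation.exists_extension_fractionField {R A K : Type*} [CommRing R] [CommRing A]
    [IsDomain A] [Field K] [Algebra R A] [Algebra A K] [Algebra R K] [IsScalarTower R A K]
    [IsFractionRing A K] (D : Derivation R A A) :
    ∃ E : Derivation R K K, ∀ x : A, E (algebraMap A K x) = algebraMap A K (D x) := by
  -- A derivation is a ring homomorphism `x ↦ x + D(x) ε` into the dual numbers. Nonzero elements go
  -- to units, so the map lifts to `K`.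
  let φ : A →+* TrivSqZeroExt K K :=
    { toFun := fun x => TrivSqZeroExt.inl (algebraMap A K x) +
        TrivSqZeroExt.inr (algebraMap A K (D x))
      map_one' := by ext <;> simp
      map_zero' := by ext <;> simp
      map_add' := fun x y => by ext <;> simp [Algebra.smul_def]
      map_mul' := fun x y => by
        refine TrivSqZeroExt.ext (by simp) ?_
        simp only [TrivSqZeroExt.snd_mul, TrivSqZeroExt.snd_add, TrivSqZeroExt.snd_inl,
          TrivSqZeroExt.snd_inr, TrivSqZeroExt.fst_add, TrivSqZeroExt.fst_inl,
          TrivSqZeroExt.fst_inr, op_smul_eq_mul, smul_eq_mul, map_mul, map_add, D.leibniz]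
        ring }
  have hφ : ∀ y : nonZeroDivisors A, IsUnit (φ y) := fun y => by
    rw [TrivSqZeroExt.isUnit_iff_isUnit_fst]
    simp only [φ, RingHom.coe_mk, MonoidHom.coe_mk, OneHom.coe_mk, TrivSqZeroExt.fst_add,
      TrivSqZeroExt.fst_inl, TrivSqZeroExt.fst_inr, add_zero]
    exact IsLocalization.map_units K y
  let ψ : K →+* TrivSqZeroExt K K := IsLocalization.lift hφ
  have hψ : ∀ x, ψ (algebraMap A K x) = φ x := fun x => IsLocalization.lift_eq hφ x
  have hfst : ∀ x : K, (ψ x).fst = x := by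
    have : ((TrivSqZeroExt.fstHom K K K).toRingHom.comp ψ) = RingHom.id K := by
      apply IsLocalization.ringHom_ext (nonZeroDivisors A)
      ext x
      simp [hψ, φ]
    intro x
    exact congrArg (fun f : K →+* K => f x) this
  have hR : ∀ r : R, ψ (algebraMap R K r) = TrivSqZeroExt.inl (algebraMap R K r) := by
    intro r
    rw [IsScalarTower.algebraMap_apply R A K, hψ]
    simp [φ]
  let L : K →ₗ[R] K :=
    { toFun := fun x => (ψ x).snd
      map_add' := by simp
      map_smul' := fun r x => by
        simp [Algebra.smul_def, hR] }
  refine ⟨Derivation.mk' L fun x y => ?_, fun x => ?_⟩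
  · simp only [L, LinearMap.coe_mk, AddHom.coe_mk, map_mul, TrivSqZeroExt.snd_mul, hfst,
      op_smul_eq_mul, smul_eq_mul]
    ring
  · change (ψ (algebraMap A K x)).snd = _
    rw [hψ]
    simp only [φ, RingHom.coe_mk, MonoidHom.coe_mk, OneHom.coe_mk, TrivSqZeroExt.snd_add,
      TrivSqZeroExt.snd_inl, TrivSqZeroExt.snd_inr, zero_add]

open Matrix in
/-- Jacobi's formula for the derivative of a determinant. -/
theorem Derivation.map_det {R K n : Type*} [CommRing R] [CommRing K] [Algebra R K]
    [Fintype n] [DecidableEq n] (D : Derivation R K K) (M : Matrix n n K) :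
    D M.det = (M.adjugate * M.map D).trace := by
  have key : ∀ (s : Finset n) (f : n → K),
      D (∏ i ∈ s, f i) = ∑ j ∈ s, D (f j) * ∏ i ∈ s.erase j, f i := by
    intro s f
    induction s using Finset.induction_on with
    | empty => simp
    | insert a s ha ih =>
      rw [Finset.prod_insert ha, D.leibniz, ih, Finset.sum_insert ha, Finset.erase_insert ha,
        smul_eq_mul, smul_eq_mul, Finset.mul_sum, add_comm, mul_comm (∏ i ∈ s, f i)]
      congr 1
      · refine Finset.sum_congr rfl fun j hj => ?_
        have hja : a ≠ j := fun h => ha (h ▸ hj)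
        rw [Finset.erase_insert_of_ne hja, Finset.prod_insert (by simp [ha])]
        ring
  have h2 : (M.adjugate * M.map D).trace = ∑ j, (M.updateCol j fun i => D (M i j)).det := by
    rw [Matrix.trace]
    refine Finset.sum_congr rfl fun j _ => ?_
    rw [← Matrix.cramer_apply, Matrix.cramer_eq_adjugate_mulVec]
    simp [Matrix.mul_apply, Matrix.mulVec, dotProduct]
  rw [h2]
  simp only [Matrix.det_apply]
  rw [map_sum, Finset.sum_comm]
  refine Finset.sum_congr rfl fun σ _ => ?_
  rw [Units.smul_def, map_zsmul, key, ← Finset.smul_sum]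
  congr 1
  refine Finset.sum_congr rfl fun j _ => ?_
  rw [← Finset.mul_prod_erase _ _ (Finset.mem_univ j)]
  congr 1
  · simp
  · refine Finset.prod_congr rfl fun i hi => ?_
    rw [Matrix.updateCol_ne (Finset.ne_of_mem_erase hi)]

/-! ### Darboux–Crum theorem for leading minors. -/

section Schrodinger

open Finset Matrix

variable {k F : Type*} [Field k] [Field F] [Algebra k F] (D : Derivation k F F)

/-- The leading principal minor of order `m` of an infinite matrix. -/
def leadingMinor (R : ℕ → ℕ → F) (m : ℕ) : F :=
  (Matrix.of fun i j : Fin m => R i j).det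

/-- Consecutive leading minors of a matrix with Wronskian-type columns are related by a linear
differential equation of second order. -/
theorem leadingMinor_schrodinger (R : ℕ → ℕ → F) (κ : ℕ → F) (σ : F) (m : ℕ)
    (hκ : ∀ i, D (κ i) = 0)
    (hD : ∀ i p, D (R i p) = κ i * σ * R i p + R i (p + 1))
    (hR : ∀ i p, R i (p + 2) = κ i ^ 2 * R i p)
    (h0 : leadingMinor R m ≠ 0) :
    ∀ g u, g = leadingMinor R (m + 1) / leadingMinor R m →
      u = D (leadingMinor R m) / leadingMinor R m →
      D (D g) = 2 * κ m * σ * D g + (κ m * D σ + κ m ^ 2 - κ m ^ 2 * σ ^ 2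
        - 2 * (D u - D σ * ∑ i ∈ range m, κ i)) * g := by
  classical
  intro g u hg hu
  set M : Matrix (Fin m) (Fin m) F := Matrix.of fun i j => R i j with hM
  have hdet : M.det ≠ 0 := h0
  have hunit : IsUnit M.det := isUnit_iff_ne_zero.mpr hdet
  -- Column `m` plus the combination `c₀` of the earlier columns vanishes in all rows `i < m`; in
  -- row `m` it equals the quotient `g` of minors.
  let c₀ : Fin m → F := -(M⁻¹ *ᵥ fun i => R i m)
  have hc₀ : M *ᵥ c₀ = -fun i : Fin m => R i m := by
    simp only [c₀, Matrix.mulVec_neg, Matrix.mulVec_mulVec, Matrix.mul_nonsing_inv _ hunit,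
      Matrix.one_mulVec]
  let c : ℕ → F := fun p => if h : p < m then c₀ ⟨p, h⟩ else if p = m then 1 else 0
  have hcm : c m = 1 := by simp [c]
  have hclt : ∀ p : Fin m, c p = c₀ p := fun p => by simp [c]
  -- Coefficients shifted by one column; `s m` is the subleading coefficient `c (m - 1)`, and `0` if
  -- `m = 0`.
  let s : ℕ → F := fun p => if p = 0 then 0 else c (p - 1)
  have hs : ∀ p, s (p + 1) = c p := fun p => by simp [s]
  have hs0 : s 0 = 0 := by simp [s]
  let G : ℕ → F := fun i => ∑ p ∈ range (m + 1), c p * R i p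
  let G₁ : ℕ → F := fun i => ∑ p ∈ range (m + 1), (D (c p) * R i p + c p * R i (p + 1))
  let H : ℕ → F := fun i => ∑ p ∈ range (m + 1), (D (D (c p)) + 2 * D (s p)) * R i p
  have hG : ∀ i < m, G i = 0 := by
    intro i hi
    have := congrFun hc₀ ⟨i, hi⟩
    simp only [Matrix.mulVec, dotProduct, Pi.neg_apply] at this
    simp only [G]
    rw [Finset.sum_range_succ, hcm, Finset.sum_range, one_mul]
    have h2 : ∑ p : Fin m, c p * R i p = ∑ p : Fin m, M ⟨i, hi⟩ p * c₀ p := by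
      refine Finset.sum_congr rfl fun p _ => ?_
      rw [hclt, hM, Matrix.of_apply, mul_comm]
    rw [h2, this]
    ring
  have hDG : ∀ i, D (G i) = κ i * σ * G i + G₁ i := by
    intro i
    simp only [G, G₁, map_sum, Finset.mul_sum, ← Finset.sum_add_distrib]
    refine Finset.sum_congr rfl fun p _ => ?_
    rw [D.leibniz, hD, smul_eq_mul, smul_eq_mul]
    ring
  have hshift : ∀ i, ∑ p ∈ range (m + 1), D (c p) * R i (p + 1)
      = ∑ p ∈ range (m + 1), D (s p) * R i p := by
    intro i
    have h1 : ∑ p ∈ range (m + 2), D (s p) * R i p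
        = ∑ p ∈ range (m + 1), D (c p) * R i (p + 1) := by
      rw [Finset.sum_range_succ', hs0, map_zero, zero_mul, add_zero]
      simp only [hs]
    rw [← h1, Finset.sum_range_succ, hs, hcm]
    simp
  have hDG₁ : ∀ i, D (G₁ i) = κ i * σ * G₁ i + H i + κ i ^ 2 * G i := by
    intro i
    have h1 : H i = ∑ p ∈ range (m + 1), (D (D (c p)) * R i p + 2 * (D (c p) * R i (p + 1))) := by
      simp only [H, add_mul, Finset.sum_add_distrib, mul_assoc, ← Finset.mul_sum]
      rw [hshift]
    rw [h1]
    simp only [G, G₁, map_sum, Finset.mul_sum, ← Finset.sum_add_distrib]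
    refine Finset.sum_congr rfl fun p _ => ?_
    rw [map_add, D.leibniz, D.leibniz, hD, hD, hR]
    simp only [smul_eq_mul]
    ring
  let v : F := -D (s m)
  -- The choice of `v` cancels column `m` in `H + 2vG`. The rest combines the first `m` columns and
  -- vanishes in the first `m` rows, so its coefficients are zero and the identity extends to every
  -- row.
  have hH : ∀ i, H i = -2 * v * G i := by
    have hc : ∀ p < m, D (D (c p)) + 2 * D (s p) + 2 * v * c p = 0 := by
      have hz : M *ᵥ (fun p : Fin m => D (D (c p)) + 2 * D (s p) + 2 * v * c p) = 0 := by
        ext i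
        have h1 : G₁ i = 0 := by
          have := hDG i
          rw [hG i i.2] at this
          simpa using this.symm
        have h2 : H i = 0 := by
          have := hDG₁ i
          rw [hG i i.2, h1] at this
          simpa using this.symm
        have h3 : ∑ p ∈ range (m + 1), (D (D (c p)) + 2 * D (s p) + 2 * v * c p) * R i p = 0 := by
          have : ∑ p ∈ range (m + 1), (D (D (c p)) + 2 * D (s p) + 2 * v * c p) * R i p
              = H i + 2 * v * G i := by
            simp only [H, G, Finset.mul_sum, ← Finset.sum_add_distrib]
            exact Finset.sum_congr rfl fun p _ => by ring
          rw [this, h2, hG i i.2]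
          ring
        rw [Finset.sum_range_succ, hcm, Finset.sum_range] at h3
        have h4 : (D (D (1 : F)) + 2 * D (s m) + 2 * v * 1) = 0 := by
          simp [v]
        rw [h4, zero_mul, add_zero] at h3
        simp only [Matrix.mulVec, dotProduct, Pi.zero_apply]
        rw [← h3]
        exact Finset.sum_congr rfl fun p _ => by rw [hM, Matrix.of_apply, mul_comm]
      intro p hp
      have := Matrix.eq_zero_of_mulVec_eq_zero hdet hz
      exact congrFun this ⟨p, hp⟩
    intro i
    simp only [H, G, Finset.mul_sum]
    refine Finset.sum_congr rfl fun p hp => ?_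
    rcases Nat.lt_succ_iff_lt_or_eq.mp (Finset.mem_range.mp hp) with h | h
    · linear_combination R i p * hc p h
    · subst h
      rw [hcm]
      simp [v]
  have hgG : g = G m := by
    have h1 : leadingMinor R (m + 1) = G m * M.det := by
      have h2 := Matrix.det_updateCol_sum (Matrix.of fun i j : Fin (m + 1) => R i j)
        (Fin.last m) (fun j => c j)
      simp only [Fin.val_last, hcm, one_smul] at h2
      rw [leadingMinor, ← h2, Matrix.det_succ_column _ (Fin.last m), Fin.sum_univ_castSucc]
      have h3 : ∀ i : Fin (m + 1), ∑ j : Fin (m + 1), c j • (Matrix.of fun i j : Fin (m + 1) =>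
          R i j) i j = G i := by
        intro i
        simp only [G, Matrix.of_apply, smul_eq_mul]
        rw [Finset.sum_range]
      rw [Finset.sum_eq_zero, zero_add]
      · rw [Matrix.updateCol_self, h3]
        congr 1
        · simp [← two_mul, pow_mul]
        · congr 1
          ext i j
          simp [Matrix.submatrix, hM, Fin.succAbove_last]
      · intro i _
        rw [Matrix.updateCol_self, h3]
        simp [hG i i.2]
    rw [hg, h1]
    exact mul_div_cancel_right₀ _ hdet
  have hsm : s m = -u + σ * ∑ i ∈ range m, κ i := by
    -- Companion matrix: `M * C` is `M` with its columns shifted by one. Its trace is `-s m`, so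
    -- Jacobi's formula expresses `s m` through `u`.
    let C : Matrix (Fin m) (Fin m) F := Matrix.of fun q p =>
      if (p : ℕ) + 1 = m then -c q else if (q : ℕ) = p + 1 then 1 else 0
    have hMD : M.map D = σ • (Matrix.diagonal (fun i : Fin m => κ i) * M) + M * C := by
      ext i p
      rw [Matrix.map_apply, hM, Matrix.of_apply, hD, Matrix.add_apply, Matrix.smul_apply,
        Matrix.diagonal_mul, Matrix.mul_apply]
      have : ∑ j, (Matrix.of fun i j : Fin m => R i j) i j * C j p = R i (p + 1) := by
        by_cases hp : (p : ℕ) + 1 = m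
        · have h1 := hG i i.2
          simp only [G] at h1
          rw [Finset.sum_range_succ, hcm, Finset.sum_range, one_mul] at h1
          rw [hp, ← sub_eq_zero]
          simp only [C, Matrix.of_apply, if_pos hp, mul_neg, Finset.sum_neg_distrib]
          rw [← neg_eq_zero, ← h1]
          simp only [mul_comm (c _)]
          ring
        · have hp' : (p : ℕ) + 1 < m := by omega
          rw [Finset.sum_eq_single ⟨p + 1, hp'⟩]
          · simp [C, hp]
          · intro q _ hq
            have : (q : ℕ) ≠ p + 1 := fun h => hq (Fin.ext h)
            simp [C, hp, this]
          · simp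
      rw [this]
      simp
      ring
    have htr : C.trace = -s m := by
      rw [Matrix.trace]
      simp only [Matrix.diag_apply, C, Matrix.of_apply]
      rcases m with _ | m
      · simp [hs0]
      · rw [Fin.sum_univ_castSucc, hs, Finset.sum_eq_zero]
        · simp
        · intro i _
          have : (i : ℕ) ≠ m := i.2.ne
          simp [this]
    have hDdet : D M.det = (σ * ∑ i ∈ range m, κ i - s m) * M.det := by
      rw [Derivation.map_det, hMD, Matrix.mul_add, Matrix.trace_add, ← Matrix.mul_assoc,
        Matrix.adjugate_mul, Matrix.mul_smul, Matrix.trace_smul, ← Matrix.mul_assoc,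
        Matrix.trace_mul_comm, ← Matrix.mul_assoc, Matrix.mul_adjugate]
      simp only [Matrix.smul_mul, Matrix.one_mul, Matrix.trace_smul, smul_eq_mul, htr,
        Matrix.trace_diagonal]
      rw [Finset.sum_range]
      ring
    have : u = σ * ∑ i ∈ range m, κ i - s m := by
      rw [hu]
      change D M.det / M.det = _
      rw [hDdet]
      exact mul_div_cancel_right₀ _ hdet
    rw [this]
    ring
  have hv : v = D u - D σ * ∑ i ∈ range m, κ i := by
    simp only [v, hsm, map_add, map_neg, D.leibniz, map_sum, hκ, smul_eq_mul]
    simp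
    ring
  have e1 := hDG m
  have e2 := hDG₁ m
  rw [hH, ← hgG] at e2
  rw [← hgG] at e1
  have e3 : G₁ m = D g - κ m * σ * g := by rw [e1]; ring
  rw [e3, map_sub, D.leibniz, D.leibniz, hκ] at e2
  simp only [smul_eq_mul] at e2
  rw [← hv]
  linear_combination e2

end Schrodinger

/-! ### Soliton polynomials as Wronskian-type minors. -/

section SolitonPolynomial

open Finset Matrix

/-- The product of `(i + j) / |i - j|` over `i ∈ I`, `j ∉ I`, where `I ⊆ {1, …, m}` is the set of
all `i + 1` with `i ∈ s`. -/
def crossRatio {m : ℕ} (s : Finset (Fin m)) : ℚ :=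
  ∏ i ∈ s, ∏ j ∈ sᶜ, (((i : ℚ) + 1 + (j + 1)) / |(i : ℚ) - j|)

/-- The tau function of the `m`-soliton solution of the Korteweg-de Vries equation with wave
numbers `1, …, m`, as a polynomial. -/
def solitonPoly (α β : ℕ → ℂ) (m : ℕ) : ℂ[X] :=
  ∑ s : Finset (Fin m), C ((crossRatio s : ℚ) : ℂ) *
    ((∏ i ∈ s, (-1) ^ ((i : ℕ) + 1) * (C (α (i + 1)) * X ^ ((i : ℕ) + 1))) *
      ∏ i ∈ sᶜ, C (β (i + 1)) * (X + 1) ^ ((i : ℕ) + 1))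

/-- The entries of the Wronskian matrix whose leading minors are the soliton polynomials. -/
def solitonEntry (α β : ℕ → ℂ) (i p : ℕ) : ℂ[X] :=
  C (((i : ℂ) + 1) / 2) ^ p * (C (α (i + 1)) * X ^ (i + 1)) -
    C (-(((i : ℂ) + 1) / 2)) ^ p * (C (β (i + 1)) * (X + 1) ^ (i + 1))

/-- Reversing the sign of the nodes outside `s` turns a Vandermonde factor into a sum exactly when
one of the two indices lies in `s`. The sign is `-1` exactly when the larger index lies outside `s`,
hence the power `(-1)^j`. -/
theorem prod_Ioi_signed_sub {m : ℕ} (s : Finset (Fin m)) :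
    ∏ i : Fin m, ∏ j ∈ Ioi i, (s.piecewise (fun i : Fin m => ((i : ℂ) + 1) / 2)
      (fun i : Fin m => -(((i : ℂ) + 1) / 2)) j - s.piecewise (fun i : Fin m => ((i : ℂ) + 1) / 2)
      (fun i : Fin m => -(((i : ℂ) + 1) / 2)) i) =
    (∏ i : Fin m, ∏ j ∈ Ioi i, (((j : ℂ) + 1) / 2 - ((i : ℂ) + 1) / 2)) *
      ((∏ j ∈ sᶜ, (-1 : ℂ) ^ (j : ℕ)) * (crossRatio s : ℚ)) := by
  classical
  have h1 : (∏ j ∈ sᶜ, (-1 : ℂ) ^ (j : ℕ))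
      = ∏ i : Fin m, ∏ j ∈ Ioi i, (if j ∈ s then 1 else -1 : ℂ) := by
    rw [Finset.prod_comm' (t' := univ) (s' := fun j => Iio j) (by simp)]
    simp only [prod_const, Fin.card_Iio]
    rw [← Finset.prod_mul_prod_compl s, Finset.prod_eq_one (s := s), one_mul]
    · exact Finset.prod_congr rfl fun j hj => by rw [if_neg (Finset.mem_compl.mp hj)]
    · intro j hj
      rw [if_pos hj, one_pow]
  have h2 : ((crossRatio s : ℚ) : ℂ) = ∏ i : Fin m, ∏ j ∈ Ioi i,
      ((if j ∈ s ∧ i ∉ s then ((j : ℂ) + i + 2) / (j - i) else 1) *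
        (if i ∈ s ∧ j ∉ s then ((j : ℂ) + i + 2) / (j - i) else 1)) := by
    have h3 := Finset.prod_prod_Ioi_mul_eq_prod_prod_off_diag
      (fun i j : Fin m => if i ∈ s ∧ j ∉ s then
        (((((i : ℚ) + 1 + (j + 1)) / |(i : ℚ) - j| : ℚ)) : ℂ) else 1)
    have h4 : ((crossRatio s : ℚ) : ℂ) = ∏ i : Fin m, ∏ j ∈ ({i}ᶜ : Finset (Fin m)),
        if j ∈ s ∧ i ∉ s then
        (((((j : ℚ) + 1 + (i + 1)) / |(j : ℚ) - i| : ℚ)) : ℂ) else 1 := by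
      rw [crossRatio, Rat.cast_prod, ← Finset.prod_mul_prod_compl sᶜ, Finset.prod_eq_one (s := sᶜᶜ),
        mul_one]
      · simp only [Rat.cast_prod]
        rw [Finset.prod_comm]
        refine Finset.prod_congr rfl fun i hi => ?_
        have hi' : i ∉ s := Finset.mem_compl.mp hi
        have : s ⊆ ({i}ᶜ : Finset (Fin m)) := by
          intro j hj
          simp only [mem_compl, mem_singleton]
          rintro rfl
          exact hi' hj
        rw [← Finset.prod_subset this]
        · exact Finset.prod_congr rfl fun j hj => by rw [if_pos ⟨hj, hi'⟩]
        · intro j _ hj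
          rw [if_neg (fun h => hj h.1)]
      · intro i hi
        refine Finset.prod_eq_one fun j _ => ?_
        rw [if_neg (fun h => h.2 (by simpa using hi))]
    rw [h4, ← h3]
    refine Finset.prod_congr rfl fun i _ => Finset.prod_congr rfl fun j hj => ?_
    have hij : (i : ℚ) < j := by exact_mod_cast Finset.mem_Ioi.mp hj
    have e1 : |(j : ℚ) - i| = j - i := abs_of_pos (by linarith)
    have e2 : |(i : ℚ) - j| = j - i := by rw [abs_sub_comm, e1]
    rw [e1, e2]
    push_cast
    congr 2
    · congr 1
      ring
    · congr 1
      ring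
  rw [h1, h2, ← Finset.prod_mul_distrib, ← Finset.prod_mul_distrib]
  refine Finset.prod_congr rfl fun i _ => ?_
  rw [← Finset.prod_mul_distrib, ← Finset.prod_mul_distrib]
  refine Finset.prod_congr rfl fun j hj => ?_
  have hij : (j : ℂ) - i ≠ 0 := by
    have : (i : ℕ) < j := Fin.lt_def.mp (Finset.mem_Ioi.mp hj)
    rw [sub_ne_zero]
    exact_mod_cast this.ne'
  by_cases hi : i ∈ s <;> by_cases hj : j ∈ s <;> simp [hi, hj] <;> field_simp <;> ring

/-- Each row is a sum of two geometric progressions with ratios `±κ`. Multilinearity in the rows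
gives a sum over subsets, each term a Vandermonde determinant with signed nodes. -/
theorem leadingMinor_solitonEntry (α β : ℕ → ℂ) (m : ℕ) :
    ∃ c : ℂ, c ≠ 0 ∧ (Matrix.of fun i j : Fin m => solitonEntry α β i j).det
      = C c * solitonPoly α β m := by
  classical
  refine ⟨(∏ i : Fin m, ∏ j ∈ Ioi i, (((j : ℂ) + 1) / 2 - ((i : ℂ) + 1) / 2)) *
    ∏ j : Fin m, (-1 : ℂ) ^ ((j : ℕ) + 1), ?_, ?_⟩
  · refine mul_ne_zero ?_ ?_
    · refine Finset.prod_ne_zero_iff.mpr fun i _ => Finset.prod_ne_zero_iff.mpr fun j hj => ?_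
      have : (i : ℕ) < j := Fin.lt_def.mp (Finset.mem_Ioi.mp hj)
      have h : (j : ℂ) - i ≠ 0 := by
        rw [sub_ne_zero]
        exact_mod_cast this.ne'
      intro h2
      apply h
      linear_combination 2 * h2
    · exact Finset.prod_ne_zero_iff.mpr fun i _ => pow_ne_zero _ (by norm_num)
  let κ : Fin m → ℂ := fun i => ((i : ℂ) + 1) / 2
  let A : Fin m → ℂ[X] := fun i => C (α (i + 1)) * X ^ ((i : ℕ) + 1)
  let B : Fin m → ℂ[X] := fun i => -(C (β (i + 1)) * (X + 1) ^ ((i : ℕ) + 1))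
  let rA : Fin m → Fin m → ℂ[X] := fun i p => A i * C (κ i) ^ (p : ℕ)
  let rB : Fin m → Fin m → ℂ[X] := fun i p => B i * C (-κ i) ^ (p : ℕ)
  have h1 : (Matrix.of fun i j : Fin m => solitonEntry α β i j) = Matrix.of (rA + rB) := by
    ext1 i j
    simp only [Matrix.of_apply, solitonEntry, Pi.add_apply, rA, rB, A, B, κ]
    ring
  have h2 : (Matrix.of (rA + rB)).det = ∑ s : Finset (Fin m), (Matrix.of (s.piecewise rA rB)).det :=
    (Matrix.detRowAlternating (n := Fin m) (R := ℂ[X])).map_add_univ rA rB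
  have h3 : ∀ s : Finset (Fin m), (Matrix.of (s.piecewise rA rB)).det =
      (∏ i, s.piecewise A B i) * C (∏ i : Fin m, ∏ j ∈ Ioi i,
        (s.piecewise κ (fun i => -κ i) j - s.piecewise κ (fun i => -κ i) i)) := by
    intro s
    have : Matrix.of (s.piecewise rA rB) = Matrix.of fun i j => s.piecewise A B i *
        Matrix.vandermonde (fun i => C (s.piecewise κ (fun i => -κ i) i)) i j := by
      ext1 i j
      by_cases hi : i ∈ s <;> simp [Finset.piecewise, hi, rA, rB, Matrix.vandermonde_apply]
    rw [this, Matrix.det_mul_column, Matrix.det_vandermonde]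
    simp only [map_prod, C_sub]
  rw [h1, h2, solitonPoly, Finset.mul_sum]
  refine Finset.sum_congr rfl fun s _ => ?_
  rw [h3, prod_Ioi_signed_sub, ← Finset.prod_mul_prod_compl s,
    Finset.prod_congr rfl (fun i hi => Finset.piecewise_eq_of_mem s A B hi),
    Finset.prod_congr (s₁ := sᶜ) rfl
      (fun i hi => Finset.piecewise_eq_of_notMem s A B (Finset.mem_compl.mp hi)),
    ← Finset.prod_mul_prod_compl s (fun j : Fin m => (-1 : ℂ) ^ ((j : ℕ) + 1))]
  simp only [A, B, map_mul, map_prod, Finset.prod_mul_distrib, map_pow, map_neg, map_one,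
    neg_mul_eq_neg_mul _ ((X + 1 : ℂ[X]) ^ _)]
  have e1 : ∀ t : Finset (Fin m), (∏ x ∈ t, -C (β (x + 1)) : ℂ[X])
      = (∏ x ∈ t, (-1)) * ∏ x ∈ t, C (β (x + 1)) := fun t => by
    rw [← Finset.prod_mul_distrib]
    simp
  have e2 : ∀ t : Finset (Fin m), (∏ x ∈ t, (-1 : ℂ[X]) ^ ((x : ℕ) + 1))
      = (∏ x ∈ t, (-1)) * ∏ x ∈ t, (-1 : ℂ[X]) ^ (x : ℕ) := fun t => by
    rw [← Finset.prod_mul_distrib]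
    exact Finset.prod_congr rfl fun x _ => by ring
  have e3 : (∏ x ∈ s, (-1 : ℂ[X]) ^ ((x : ℕ) + 1)) * (∏ x ∈ s, (-1 : ℂ[X]) ^ ((x : ℕ) + 1)) = 1 := by
    rw [← Finset.prod_mul_distrib]
    refine Finset.prod_eq_one fun x _ => ?_
    rw [← mul_pow]
    simp
  rw [e1, e2 sᶜ]
  linear_combination (-((∏ x ∈ s, C (α (x + 1))) * (∏ x ∈ s, X ^ ((x : ℕ) + 1)) *
    (((∏ x ∈ sᶜ, (-1 : ℂ[X])) * ∏ x ∈ sᶜ, C (β (x + 1))) * ∏ x ∈ sᶜ, (X + 1) ^ ((x : ℕ) + 1)) *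
    ((∏ x : Fin m, ∏ y ∈ Ioi x, C (((y : ℂ) + 1) / 2 - ((x : ℂ) + 1) / 2)) *
      ((∏ x ∈ sᶜ, (-1) ^ (x : ℕ)) * C ((crossRatio s : ℚ) : ℂ))))) * e3

theorem eval_zero_solitonPoly (α β : ℕ → ℂ) (m : ℕ) :
    (solitonPoly α β m).eval 0 = ∏ i ∈ range m, β (i + 1) := by
  classical
  rw [solitonPoly, eval_finsetSum, Finset.sum_eq_single ∅]
  · simp [crossRatio, eval_prod, Finset.prod_range]
  · intro s _ hs
    obtain ⟨i, hi⟩ := Finset.nonempty_iff_ne_empty.mpr hs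
    simp only [eval_mul, eval_prod]
    rw [Finset.prod_eq_zero hi (by simp)]
    simp
  · simp

theorem eval_neg_one_solitonPoly (α β : ℕ → ℂ) (m : ℕ) :
    (solitonPoly α β m).eval (-1) = ∏ i ∈ range m, α (i + 1) := by
  classical
  rw [solitonPoly, eval_finsetSum, Finset.sum_eq_single univ]
  · have : ∀ i : ℕ, (-1 : ℂ) ^ (i + 1) * (α (i + 1) * (-1) ^ (i + 1)) = α (i + 1) := fun i => by
      rw [mul_left_comm, ← mul_pow]
      simp
    simp [crossRatio, eval_prod, Finset.prod_range, this]
  · intro s _ hs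
    obtain ⟨i, hi⟩ : sᶜ.Nonempty := by
      rw [Finset.nonempty_iff_ne_empty]
      simpa using hs
    simp only [eval_mul, eval_prod]
    rw [Finset.prod_eq_zero (s := sᶜ) hi (by simp)]
    simp
  · simp

theorem X_pow_dvd_solitonPoly (α β : ℕ → ℂ) (m : ℕ) (h : β (m + 1) = 0) :
    X ^ (m + 1) ∣ solitonPoly α β (m + 1) := by
  classical
  refine Finset.dvd_sum fun s _ => ?_
  by_cases hs : Fin.last m ∈ s
  · have h1 := Finset.dvd_prod_of_mem
      (fun i : Fin (m + 1) => (-1) ^ ((i : ℕ) + 1) * (C (α (i + 1)) * X ^ ((i : ℕ) + 1))) hs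
    simp only [Fin.val_last] at h1
    exact Dvd.dvd.mul_left (Dvd.dvd.mul_right
      ((Dvd.dvd.mul_left (dvd_mul_left _ _) _).trans h1) _) _
  · rw [Finset.prod_eq_zero (s := sᶜ) (Finset.mem_compl.mpr hs) (by simp [h])]
    simp

theorem X_add_one_pow_dvd_solitonPoly (α β : ℕ → ℂ) (m : ℕ) (h : α (m + 1) = 0) :
    (X + 1) ^ (m + 1) ∣ solitonPoly α β (m + 1) := by
  classical
  refine Finset.dvd_sum fun s _ => ?_
  by_cases hs : Fin.last m ∈ s
  · rw [Finset.prod_eq_zero (s := s) hs (by simp [h])]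
    simp
  · have h1 := Finset.dvd_prod_of_mem
      (fun i : Fin (m + 1) => C (β (i + 1)) * (X + 1) ^ ((i : ℕ) + 1)) (Finset.mem_compl.mpr hs)
    simp only [Fin.val_last] at h1
    exact Dvd.dvd.mul_left (Dvd.dvd.mul_left ((dvd_mul_left _ _).trans h1) _) _

theorem solitonPoly_congr {α α' β β' : ℕ → ℂ} {m : ℕ} (hα : ∀ i < m, α (i + 1) = α' (i + 1))
    (hβ : ∀ i < m, β (i + 1) = β' (i + 1)) : solitonPoly α β m = solitonPoly α' β' m := by
  simp only [solitonPoly]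
  refine Finset.sum_congr rfl fun s _ => ?_
  rw [Finset.prod_congr (s₁ := s) rfl fun i _ => by rw [hα i i.2],
    Finset.prod_congr (s₁ := sᶜ) rfl fun i _ => by rw [hβ i i.2]]

/-- Sorts the subsets by whether they contain the last index. The two parts are divisible by high
powers of `X + 1` and `X`, and each is a soliton polynomial over the same predecessor. -/
theorem solitonPoly_succ_eq_add (α β : ℕ → ℂ) (m : ℕ) :
    solitonPoly α β (m + 1) = solitonPoly (Function.update α (m + 1) 0) β (m + 1) +
      solitonPoly α (Function.update β (m + 1) 0) (m + 1) := by
  classical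
  simp only [solitonPoly, ← Finset.sum_add_distrib, ← mul_add]
  refine Finset.sum_congr rfl fun s _ => ?_
  congr 1
  have hne : ∀ i : Fin (m + 1), i ≠ Fin.last m → (i : ℕ) + 1 ≠ m + 1 := fun i hi h =>
    hi (Fin.ext (by simpa using h))
  by_cases hs : Fin.last m ∈ s
  · rw [Finset.prod_eq_zero (s := s) (i := Fin.last m)
      (f := fun i : Fin (m + 1) => (-1) ^ ((i : ℕ) + 1) *
        (C (Function.update α (m + 1) 0 (i + 1)) * X ^ ((i : ℕ) + 1))) hs (by simp),
      zero_mul, zero_add]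
    congr 1
    refine Finset.prod_congr rfl fun i hi => ?_
    rw [Function.update_of_ne (hne i fun h => Finset.mem_compl.mp hi (h ▸ hs))]
  · rw [Finset.prod_eq_zero (s := sᶜ) (i := Fin.last m)
      (f := fun i : Fin (m + 1) => C (Function.update β (m + 1) 0 (i + 1)) *
        (X + 1) ^ ((i : ℕ) + 1)) (Finset.mem_compl.mpr hs) (by simp),
      mul_zero, add_zero]
    congr 1
    refine Finset.prod_congr rfl fun i hi => ?_
    rw [Function.update_of_ne (hne i fun h => hs (h ▸ hi))]

end SolitonPolynomial

/-! ### The linear equation for consecutive soliton polynomials. -/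

section FractionField

variable {F : Type*} [Field F] [CharZero F] [Algebra ℂ F] [Algebra ℂ[X] F]
  [IsFractionRing ℂ[X] F] {D : Derivation ℂ F F}

local notation "ι" => algebraMap ℂ[X] F

/-- Apply `leadingMinor_schrodinger` with `κ i = (i+1)/2` and `σ = 2Z + 1`. As `σ² - 1 = 4Z(Z+1)`,
`Dσ = 2Z(Z+1)` and `∑_{i<m} κ i = m(m+1)/4`, all terms in the potential other than `-2 Du` cancel.
-/
theorem solitonPoly_schrodinger
    (hD : ∀ p : ℂ[X], D (ι p) = ι (X * (X + 1) * derivative p)) (α β : ℕ → ℂ) (m : ℕ)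
    (h0 : solitonPoly α β m ≠ 0) (g u : F)
    (hg : g = ι (solitonPoly α β (m + 1)) / ι (solitonPoly α β m))
    (hu : u = D (ι (solitonPoly α β m)) / ι (solitonPoly α β m)) :
    D (D g) = ((m : F) + 1) * (2 * ι X + 1) * D g - 2 * D u * g := by
  have hinj : Function.Injective ι := IsFractionRing.injective ℂ[X] F
  have hC : ∀ c : ℂ, D (ι (C c)) = 0 := fun c => by simp [hD]
  have hX : D (ι X) = ι X * (ι X + 1) := by simp [hD]
  have hminor : ∀ m, ∃ c : ℂ, c ≠ 0 ∧
      leadingMinor (fun i p => ι (solitonEntry α β i p)) m = ι (C c) * ι (solitonPoly α β m) := by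
    intro m
    obtain ⟨c, hc, h⟩ := leadingMinor_solitonEntry α β m
    refine ⟨c, hc, ?_⟩
    rw [← map_mul, ← h, leadingMinor, RingHom.map_det]
    rfl
  obtain ⟨c, hc, h1⟩ := hminor m
  obtain ⟨c', hc', h2⟩ := hminor (m + 1)
  have hιc : ι (C c) ≠ 0 := by simpa [map_ne_zero_iff _ hinj] using hc
  have hιc' : ι (C c') ≠ 0 := by simpa [map_ne_zero_iff _ hinj] using hc'
  have hU : ι (solitonPoly α β m) ≠ 0 := by simpa [map_ne_zero_iff _ hinj] using h0
  have hk : ∀ i : ℕ, (ι (C (((i : ℂ) + 1) / 2)) : F) = ((i : F) + 1) / 2 := by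
    intro i
    have h2F : (2 : F) ≠ 0 := two_ne_zero
    have : (2 : ℂ[X]) * C (((i : ℂ) + 1) / 2) = (i : ℂ[X]) + 1 := by
      rw [show (2 : ℂ[X]) = C 2 from rfl, ← C_mul, mul_div_cancel₀ _ two_ne_zero]
      simp
    rw [eq_div_iff h2F, mul_comm]
    have := congrArg ι this
    simpa [map_ofNat] using this
  have key := leadingMinor_schrodinger D (fun i p => ι (solitonEntry α β i p))
    (fun i => ι (C (((i : ℂ) + 1) / 2))) (2 * ι X + 1) m (fun i => hC _)
    (fun i p => by
      have h3 : X * (X + 1) * derivative (solitonEntry α β i p) =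
          C (((i : ℂ) + 1) / 2) * (2 * X + 1) * solitonEntry α β i p + solitonEntry α β i (p + 1) := by
        have h4 : ((i : ℂ[X]) + 1) = 2 * C (((i : ℂ) + 1) / 2) := by
          rw [show (2 : ℂ[X]) = C 2 from rfl, ← C_mul, mul_div_cancel₀ _ two_ne_zero]
          simp
        simp only [solitonEntry, C_neg]
        simp only [derivative_sub, derivative_mul, ← C_neg, ← C_pow, derivative_C, zero_mul,
          derivative_pow, derivative_one, derivative_X, zero_add,
          Nat.add_sub_cancel, Nat.cast_add, Nat.cast_one, map_add, map_one, add_zero, mul_one]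
        simp only [C_pow, C_neg, map_natCast, h4]
        ring
      rw [hD, h3]
      simp [map_ofNat])
    (fun i p => by
      rw [← map_pow, ← map_mul]
      congr 1
      simp only [solitonEntry, C_neg]
      ring)
    (by rw [h1]; exact mul_ne_zero hιc hU)
    (ι (C c') / ι (C c) * g) u
    (by rw [h1, h2, hg]; field_simp)
    (by rw [h1, hu, D.leibniz, hC]; simp; field_simp)
  have hcc : D (ι (C c') / ι (C c)) = 0 := by
    rw [D.leibniz_div, hC, hC]
    simp
  have hcc0 : ι (C c') / ι (C c) ≠ 0 := div_ne_zero hιc' hιc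
  have hsum : ∑ i ∈ Finset.range m, (ι (C (((i : ℂ) + 1) / 2)) : F) = (m : F) * (m + 1) / 4 := by
    have h2F : (2 : F) ≠ 0 := two_ne_zero
    have h4F : (4 : F) ≠ 0 := by norm_num
    simp only [hk]
    clear h1 h2 key hU hg hu h0
    induction m with
    | zero => simp
    | succ n ih =>
      rw [Finset.sum_range_succ, ih]
      push_cast
      field_simp
      ring
  have h2D : D (2 * ι X + 1) = 2 * (ι X * (ι X + 1)) := by
    rw [map_add, D.leibniz, hX, show (2 : F) = ι (C 2) from (map_ofNat ι 2).symm, hC]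
    simp
  rw [hsum, hk, h2D] at key
  simp only [D.leibniz, hcc, smul_eq_mul, mul_zero, add_zero] at key
  have h2F : (2 : F) ≠ 0 := two_ne_zero
  have h4F : (4 : F) ≠ 0 := by norm_num
  have hm2 : ((m : F) + 1) = 2 * (((m : F) + 1) / 2) := by field_simp
  apply mul_left_cancel₀ hcc0
  rw [key]
  field_simp
  ring

end FractionField

/-! ### The algebraic recursion for logarithmic derivatives. -/

section DifferentialAlgebra

variable {k F : Type*} [Field k] [Field F] [CharZero F] [Algebra k F] (D : Derivation k F F)

/-- The function `P = a Z + b W - 8 u` with `W = Z + 1`. -/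
def potP (Z a b u : F) : F := a * Z + b * (Z + 1) - 8 * u

/-- The function `X = (Z + W) P - 2 P'`, which is four times the `t`-derivative of the
Hamiltonian. -/
def potX (Z a b u : F) : F := (2 * Z + 1) * potP Z a b u - 2 * D (potP Z a b u)

/-- The function `Q = P - (Z + W) X`. -/
def potQ (Z a b u : F) : F := potP Z a b u - (2 * Z + 1) * potX D Z a b u

/-- The relations between the logarithmic derivative `u` of a tau function and the difference `q`
of the logarithmic derivatives of the preceding tau function and of this one. -/
structure TauPair (Z a b m u q : F) : Prop where
  deriv_potX : D (potX D Z a b u) =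
    2 * q * (potX D Z a b u + (2 * m + 1) ^ 2) - (2 * m + 1) / 2 * potQ D Z a b u
  quadric : (potQ D Z a b u - 4 * (2 * m + 1) * q) ^ 2 + 16 * q ^ 2 * potX D Z a b u =
    4 * (Z * (Z + 1)) * (potX D Z a b u - a) * (potX D Z a b u - b)
  riccati : 2 * D u + D q + q ^ 2 = -m * (2 * Z + 1) * q

variable {D} {Z a b m u q : F}

/-- The third-order equation satisfied by the logarithmic derivative of a tau function. -/
theorem TauPair.cubic (h : TauPair D Z a b m u q) :
    4 * D (potX D Z a b u) ^ 2 + potX D Z a b u * potQ D Z a b u ^ 2 =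
      4 * (Z * (Z + 1)) * (potX D Z a b u - a) * (potX D Z a b u - b) *
        (potX D Z a b u + (2 * m + 1) ^ 2) := by
  rw [h.deriv_potX]
  -- After `DX` is substituted, the left side is `X + (2m+1)²` times the left side of `quadric`,
  -- which removes `q`.
  linear_combination (potX D Z a b u + (2 * m + 1) ^ 2) * h.quadric

theorem TauPair.zero (hZ : D Z = Z * (Z + 1)) (ha : D a = 0) (hb : D b = 0) :
    TauPair D Z a b 0 0 0 := by
  have hP : potP Z a b 0 = a * Z + b * (Z + 1) := by simp [potP]
  have hX : potX D Z a b 0 = b * (Z + 1) - a * Z := by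
    rw [potX, hP]
    simp only [map_add, D.leibniz, hZ, ha, hb, smul_eq_mul, Derivation.map_one_eq_zero]
    ring
  have hDX : D (potX D Z a b 0) = (b - a) * (Z * (Z + 1)) := by
    rw [hX]
    simp only [map_add, map_sub, D.leibniz, hZ, ha, hb, smul_eq_mul, Derivation.map_one_eq_zero]
    ring
  refine ⟨?_, ?_, ?_⟩
  · rw [hDX, potQ, hX, hP]
    ring
  · rw [potQ, hX, hP]
    ring
  · simp

/-- This Riccati equation says that a function with logarithmic derivative `p` solves the linear
equation satisfied by `U_{m+1}/U_m`. It comes from differentiating `e1`, which is linear in `p` and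
`q`. -/
theorem TauPair.riccati_next (h : TauPair D Z a b m u q) (hZ : D Z = Z * (Z + 1))
    (hm : D m = 0) {p : F}
    (hT : potX D Z a b u + (2 * m + 1) ^ 2 ≠ 0)
    (hp : p = D (potX D Z a b u) / (potX D Z a b u + (2 * m + 1) ^ 2) - q) :
    2 * D u + D p + p ^ 2 = (m + 1) * (2 * Z + 1) * p := by
  obtain ⟨h1, h2, h3⟩ := h
  have hDP : D (potP Z a b u) = ((2 * Z + 1) * potP Z a b u - potX D Z a b u) / 2 := by
    rw [potX]; ring
  have hDQ : D (potQ D Z a b u) = (2 * Z + 1) * potQ D Z a b u / 2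
      - (2 * Z + 1) * D (potX D Z a b u) := by
    have : D (2 : F) = 0 := by exact_mod_cast D.map_natCast 2
    rw [potQ, map_sub, hDP]
    simp only [map_add, D.leibniz, hZ, smul_eq_mul, Derivation.map_one_eq_zero, this]
    ring
  set X := potX D Z a b u
  set Q := potQ D Z a b u
  have hDc : D ((2 * m + 1) ^ 2) = 0 := by
    have : D (2 : F) = 0 := by exact_mod_cast D.map_natCast 2
    simp [D.leibniz_pow, D.leibniz, hm, this]
  have hDc2 : D (2 * m + 1) = 0 := by
    have : D (2 : F) = 0 := by exact_mod_cast D.map_natCast 2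
    simp [D.leibniz, hm, this]
  have e0 : (X + (2 * m + 1) ^ 2) * (p + q) = D X := by
    rw [hp]; field_simp; ring
  have e1 : 2 * (X + (2 * m + 1) ^ 2) * p = 2 * (X + (2 * m + 1) ^ 2) * q - (2 * m + 1) * Q := by
    linear_combination 2 * e0 + 2 * h1
  have e2 := congrArg D e1
  have h2D : D (2 : F) = 0 := by exact_mod_cast D.map_natCast 2
  rw [map_sub, D.leibniz, D.leibniz (2 * (X + (2 * m + 1) ^ 2)) q, D.leibniz (2 * m + 1) Q,
    D.leibniz 2, map_add, hDc, hDc2, h2D, hDQ] at e2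
  simp only [smul_eq_mul, add_zero, mul_zero] at e2
  have hT2 : 2 * (X + (2 * m + 1) ^ 2) ≠ 0 := mul_ne_zero two_ne_zero hT
  apply mul_left_cancel₀ hT2
  linear_combination e2 + 2 * (X + (2 * m + 1) ^ 2) * h3 - (2 * Z + 1) / 2 * e1
    - (2 * m + 1) * (2 * Z + 1) * e0 + 2 * (p - q) * e0

/-- Two uses of Vieta's formulas. By `e1`, `-p` is the other root of `quadric` as a quadratic in
`q`. Then, for fixed `P` and `p`, the old and new values of `X` are the two roots of one monic
quadratic, whose root sum is `hX'`. -/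
theorem TauPair.next (h : TauPair D Z a b m u q) (hZ : D Z = Z * (Z + 1))
    (hm : D m = 0) (ha : D a = 0) (hb : D b = 0) {p : F}
    (hT : potX D Z a b u + (2 * m + 1) ^ 2 ≠ 0)
    (hp : p = D (potX D Z a b u) / (potX D Z a b u + (2 * m + 1) ^ 2) - q) :
    TauPair D Z a b (m + 1) (u + p) (-p) := by
  have h4 := h.riccati_next hZ hm hT hp
  obtain ⟨h1, h2, h3⟩ := h
  have h2D : D (2 : F) = 0 := by exact_mod_cast D.map_natCast 2
  have h4D : D (4 : F) = 0 := by exact_mod_cast D.map_natCast 4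
  have h8D : D (8 : F) = 0 := by exact_mod_cast D.map_natCast 8
  have h16D : D (16 : F) = 0 := by exact_mod_cast D.map_natCast 16
  have hDP : D (potP Z a b u) = ((2 * Z + 1) * potP Z a b u - potX D Z a b u) / 2 := by
    rw [potX]; ring
  have hDu : 8 * D u = (a + b) * (Z * (Z + 1)) - D (potP Z a b u) := by
    rw [potP]
    simp only [map_add, map_sub, D.leibniz, hZ, ha, hb, smul_eq_mul, Derivation.map_one_eq_zero,
      h8D]
    ring
  have hP' : potP Z a b (u + p) = potP Z a b u - 8 * p := by
    rw [potP, potP]; ring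
  have hX' : potX D Z a b (u + p) = -potX D Z a b u + 8 * (2 * m + 1) * (2 * Z + 1) * p
      - 16 * p ^ 2 - 4 * (a + b) * (Z * (Z + 1)) + 2 * (2 * Z + 1) * potP Z a b u := by
    rw [potX, hP', map_sub, D.leibniz 8, h8D]
    simp only [smul_eq_mul, mul_zero, add_zero]
    linear_combination 16 * h4 - 4 * hDu + 2 * hDP
  have hQ : potQ D Z a b u = potP Z a b u - (2 * Z + 1) * potX D Z a b u := rfl
  have hQ' : potQ D Z a b (u + p) = potP Z a b u - 8 * p
      - (2 * Z + 1) * potX D Z a b (u + p) := by rw [potQ, hP']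
  set X := potX D Z a b u
  set Q := potQ D Z a b u
  set P := potP Z a b u
  have e0 : (X + (2 * m + 1) ^ 2) * (p + q) = D X := by
    rw [hp]; field_simp; ring
  have e1 : 2 * (X + (2 * m + 1) ^ 2) * p = 2 * (X + (2 * m + 1) ^ 2) * q - (2 * m + 1) * Q := by
    linear_combination 2 * e0 + 2 * h1
  have h2p : (Q + 4 * (2 * m + 1) * p) ^ 2 + 16 * p ^ 2 * X =
      4 * (Z * (Z + 1)) * (X - a) * (X - b) := by
    linear_combination h2 + 8 * (p + q) * e1
  have hDX : D X = 2 * p * (X + (2 * m + 1) ^ 2) + (2 * m + 1) / 2 * Q := by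
    linear_combination h1 - e1
  refine ⟨?_, ?_, ?_⟩
  · have hDX' : D (potX D Z a b (u + p)) = -D X + 8 * (2 * m + 1) * (2 * (Z * (Z + 1)) * p
        + (2 * Z + 1) * D p) - 32 * p * D p - 4 * (a + b) * ((2 * Z + 1) * (Z * (Z + 1)))
        + 4 * (Z * (Z + 1)) * P + 2 * (2 * Z + 1) * D P := by
      rw [hX']
      simp only [map_add, map_sub, map_neg, D.leibniz, D.leibniz_pow, hZ, ha, hb, hm, smul_eq_mul,
        Derivation.map_one_eq_zero, h2D, h4D, h8D, h16D]
      simp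
      ring
    have hDp : D p = (m + 1) * (2 * Z + 1) * p - p ^ 2 - (a + b) * (Z * (Z + 1)) / 4
        + ((2 * Z + 1) * P - X) / 8 := by
      linear_combination h4 - hDu / 4 + hDP / 4
    rw [hDX', hQ', hX', hDp, hDP, hDX, hQ]
    ring
  · rw [hQ']
    rw [hQ] at h2p
    linear_combination h2p + (potX D Z a b (u + p) - X) * hX'
  · rw [map_add, map_neg]
    linear_combination h4

end DifferentialAlgebra

/-! ### Indicial exponents and the Toda equation. -/

/-- A polynomial solution of a first-order linear equation with a simple singularity at `ζ` and
exponent `m` there vanishes if it has a zero of order more than `m`. -/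
theorem Polynomial.eq_zero_of_indicial {M d N E : ℂ[X]} {ζ : ℂ} {m : ℕ}
    (hN : N.eval ζ = 0) (hN' : (derivative N).eval ζ ≠ 0) (hd : d.eval ζ ≠ 0)
    (hE : E.eval ζ = m * (derivative N).eval ζ * d.eval ζ)
    (heq : N * derivative M * d = M * E) (hdvd : (X - C ζ) ^ (m + 1) ∣ M) : M = 0 := by
  by_contra hM
  obtain ⟨M', hM', hndvd⟩ := exists_eq_pow_rootMultiplicity_mul_and_not_dvd M hM ζ
  have hle : m + 1 ≤ rootMultiplicity ζ M := (le_rootMultiplicity_iff hM).mpr hdvd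
  obtain ⟨r, hr⟩ : ∃ r, rootMultiplicity ζ M = r + 1 := ⟨rootMultiplicity ζ M - 1, by omega⟩
  rw [hr] at hM' hle
  obtain ⟨N', rfl⟩ := dvd_iff_isRoot.mpr hN
  have hM'0 : M'.eval ζ ≠ 0 := fun h => hndvd (dvd_iff_isRoot.mpr h)
  have hc : (X - C ζ) ^ (r + 1) * (N' * ((r + 1 : ℂ[X]) * M' + (X - C ζ) * derivative M') * d)
      = (X - C ζ) ^ (r + 1) * (M' * E) := by
    rw [hM'] at heq
    simp only [derivative_mul, derivative_pow, derivative_sub, derivative_X, derivative_C, sub_zero,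
      mul_one, Nat.add_sub_cancel, Nat.cast_add, Nat.cast_one, map_add, map_one, map_natCast] at heq
    linear_combination heq
  have h1 := mul_left_cancel₀ (pow_ne_zero _ (X_sub_C_ne_zero ζ)) hc
  have h2 := congrArg (eval ζ) h1
  simp only [eval_mul, eval_add, eval_sub, eval_X, eval_C, sub_self, zero_mul, add_zero, hE,
    derivative_mul, derivative_sub, derivative_X, derivative_C, sub_zero, one_mul, eval_one,
    eval_natCast] at h2
  simp only [derivative_mul, derivative_sub, derivative_X, derivative_C, sub_zero, one_mul,
    eval_add, eval_mul, eval_sub, eval_X, eval_C, sub_self, zero_mul, add_zero] at hN'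
  -- With `M` of exact order `r + 1` at `ζ`, comparing lowest-order terms forces `r + 1 = m`.
  have h3 : ((r : ℂ) + 1 - m) * (N'.eval ζ * M'.eval ζ * d.eval ζ) = 0 := by
    linear_combination h2
  have h4 : (r : ℂ) + 1 - m = 0 :=
    (mul_eq_zero.mp h3).resolve_right (mul_ne_zero (mul_ne_zero hN' hM'0) hd)
  have h5 : r + 1 = m := by
    have : ((r + 1 : ℕ) : ℂ) = m := by
      push_cast
      linear_combination h4
    exact_mod_cast this
  omega

/-- The numerator of `P` for `u = U' / U`. -/
def numP (a b : ℂ) (U : ℂ[X]) : ℂ[X] :=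
  (C a * X + C b * (X + 1)) * U - 8 * (X * (X + 1)) * derivative U

/-- The numerator of `X` for `u = U' / U`. -/
def numX (a b : ℂ) (U : ℂ[X]) : ℂ[X] :=
  (2 * X + 1) * numP a b U * U -
    2 * (X * (X + 1)) * (derivative (numP a b U) * U - numP a b U * derivative U)

/-- The numerator of the derivative of `X` for `u = U' / U`. -/
def numDX (a b : ℂ) (U : ℂ[X]) : ℂ[X] :=
  X * (X + 1) * (derivative (numX a b U) * U - 2 * numX a b U * derivative U)

section FractionField

variable {F : Type*} [Field F] [Algebra ℂ F] [Algebra ℂ[X] F] {D : Derivation ℂ F F}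

local notation "ι" => algebraMap ℂ[X] F

theorem potP_eq_div (hD : ∀ p : ℂ[X], D (ι p) = ι (X * (X + 1) * derivative p)) (a b : ℂ)
    {U : ℂ[X]} (hU : ι U ≠ 0) :
    potP (ι X) (ι (C a)) (ι (C b)) (D (ι U) / ι U) = ι (numP a b U) / ι U := by
  rw [potP, hD, numP]
  simp only [map_mul, map_add, map_sub, map_one, map_ofNat]
  field_simp

theorem potX_eq_div (hD : ∀ p : ℂ[X], D (ι p) = ι (X * (X + 1) * derivative p)) (a b : ℂ)
    {U : ℂ[X]} (hU : ι U ≠ 0) :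
    potX D (ι X) (ι (C a)) (ι (C b)) (D (ι U) / ι U) = ι (numX a b U) / ι U ^ 2 := by
  rw [potX, potP_eq_div hD a b hU, D.leibniz_div, hD, hD, numX]
  simp only [map_mul, map_add, map_sub, map_one, map_ofNat, smul_eq_mul]
  field_simp

theorem deriv_potX_eq_div (hD : ∀ p : ℂ[X], D (ι p) = ι (X * (X + 1) * derivative p)) (a b : ℂ)
    {U : ℂ[X]} (hU : ι U ≠ 0) :
    D (potX D (ι X) (ι (C a)) (ι (C b)) (D (ι U) / ι U)) = ι (numDX a b U) / ι U ^ 3 := by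
  rw [potX_eq_div hD a b hU, D.leibniz_div, D.leibniz_pow, hD, hD, numDX]
  simp only [map_mul, map_add, map_sub, map_one, map_ofNat, smul_eq_mul, nsmul_eq_mul]
  field_simp
  push_cast
  ring

variable [IsFractionRing ℂ[X] F]

/-- Abel's identity for two solutions, with a common denominator, of a linear differential
equation of second order. -/
theorem wronskian_equation (hD : ∀ p : ℂ[X], D (ι p) = ι (X * (X + 1) * derivative p))
    {R S d : ℂ[X]} (hd : ι d ≠ 0) {m : ℕ} {B : F}
    (hR : D (D (ι R / ι d)) = ((m : F) + 1) * (2 * ι X + 1) * D (ι R / ι d) - B * (ι R / ι d))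
    (hS : D (D (ι S / ι d)) = ((m : F) + 1) * (2 * ι X + 1) * D (ι S / ι d) - B * (ι S / ι d)) :
    X * (X + 1) * derivative (R * derivative S - derivative R * S) * d =
      (R * derivative S - derivative R * S) *
        (2 * (X * (X + 1)) * derivative d + (m : ℂ[X]) * (2 * X + 1) * d) := by
  have hinj : Function.Injective ι := IsFractionRing.injective ℂ[X] F
  set M := R * derivative S - derivative R * S with hM
  have h1 : ι R / ι d * D (ι S / ι d) - ι S / ι d * D (ι R / ι d)
      = ι (X * (X + 1) * M) / ι d ^ 2 := by
    rw [D.leibniz_div, D.leibniz_div, hD, hD, hD, hM]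
    simp only [map_mul, map_add, map_sub, map_one, smul_eq_mul]
    field_simp
    ring
  have h2 : D (ι (X * (X + 1) * M) / ι d ^ 2)
      = ((m : F) + 1) * (2 * ι X + 1) * (ι (X * (X + 1) * M) / ι d ^ 2) := by
    rw [← h1, map_sub, D.leibniz (ι R / ι d), D.leibniz (ι S / ι d), hR, hS]
    simp only [smul_eq_mul]
    ring
  rw [D.leibniz_div, D.leibniz_pow, hD, hD] at h2
  simp only [map_mul, map_add, map_one, smul_eq_mul, nsmul_eq_mul, derivative_mul, derivative_X, derivative_one, add_zero, mul_one, one_mul] at h2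
  have hX0 : ι X ≠ 0 := (map_ne_zero_iff _ hinj).mpr X_ne_zero
  have hX1 : ι X + 1 ≠ 0 := by
    have : (X + 1 : ℂ[X]) ≠ 0 := X_add_C_ne_zero (1 : ℂ)
    have h3 := (map_ne_zero_iff _ hinj).mpr this
    simpa using h3
  apply hinj
  apply mul_left_cancel₀ hd
  simp only [map_mul, map_add, map_one, map_natCast, map_ofNat]
  field_simp at h2
  push_cast at h2
  linear_combination h2

variable [CharZero F]

/-- The Toda equation: two consecutive tau functions determine the next one. -/
theorem toda_equation (hD : ∀ p : ℂ[X], D (ι p) = ι (X * (X + 1) * derivative p))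
    (a b : ℂ) (m : ℕ) {U₀ U Y₁ Y₂ : ℂ[X]}
    (h00 : U₀.eval 0 ≠ 0) (h01 : U₀.eval (-1) ≠ 0) (h10 : U.eval 0 ≠ 0) (h11 : U.eval (-1) ≠ 0)
    (h20 : (Y₁ + Y₂).eval 0 ≠ 0) (h21 : (Y₁ + Y₂).eval (-1) ≠ 0)
    (hT0 : (Y₁ + Y₂).eval 0 * U₀.eval 0 = (b + (2 * m + 1) ^ 2) * U.eval 0 ^ 2)
    (hT1 : (Y₁ + Y₂).eval (-1) * U₀.eval (-1) = (a + (2 * m + 1) ^ 2) * U.eval (-1) ^ 2)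
    (hY₁ : (X + 1) ^ (m + 1) ∣ Y₁) (hY₂ : X ^ (m + 1) ∣ Y₂)
    {u q p : F} (hu : u = D (ι U) / ι U) (hq : q = D (ι U₀) / ι U₀ - u)
    (hpair : TauPair D (ι X) (ι (C a)) (ι (C b)) m u q)
    (hp : p = D (potX D (ι X) (ι (C a)) (ι (C b)) u) /
      (potX D (ι X) (ι (C a)) (ι (C b)) u + (2 * m + 1) ^ 2) - q)
    (hode : ∀ Y, Y = Y₁ ∨ Y = Y₂ → D (D (ι Y / ι U)) =
      ((m : F) + 1) * (2 * ι X + 1) * D (ι Y / ι U) - 2 * D u * (ι Y / ι U)) :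
    potX D (ι X) (ι (C a)) (ι (C b)) u + (2 * m + 1) ^ 2 ≠ 0 ∧
      D (ι (Y₁ + Y₂)) / ι (Y₁ + Y₂) = u + p := by
  have hinj : Function.Injective ι := IsFractionRing.injective ℂ[X] F
  have ne_of_eval : ∀ {p : ℂ[X]} {x : ℂ}, p.eval x ≠ 0 → ι p ≠ 0 := by
    intro p x hp h
    apply hp
    rw [(map_eq_zero_iff _ hinj).mp h, eval_zero]
  have hU : ι U ≠ 0 := ne_of_eval h10
  have hU₀ : ι U₀ ≠ 0 := ne_of_eval h00
  have hX : D (ι X) = ι X * (ι X + 1) := by simp [hD]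
  have hDm : D (m : F) = 0 := D.map_natCast m
  set T := potX D (ι X) (ι (C a)) (ι (C b)) u + (2 * (m : F) + 1) ^ 2 with hTdef
  let N : ℂ[X] := numX a b U + (2 * (m : ℂ[X]) + 1) ^ 2 * U ^ 2
  have hTN : T = ι N / ι U ^ 2 := by
    rw [hTdef, hu, potX_eq_div hD a b hU]
    simp only [N, map_add, map_mul, map_pow, map_one, map_natCast, map_ofNat]
    field_simp
  have hN0 : N.eval 0 = (b + (2 * m + 1) ^ 2) * U.eval 0 ^ 2 := by
    simp [N, numX, numP]
    ring
  have hN1 : N.eval (-1) = (a + (2 * m + 1) ^ 2) * U.eval (-1) ^ 2 := by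
    simp [N, numX, numP]
    ring
  have hN : ι N ≠ 0 := ne_of_eval (x := 0) (by rw [hN0, ← hT0]; exact mul_ne_zero h20 h00)
  have hT : T ≠ 0 := by
    rw [hTN]
    exact div_ne_zero hN (pow_ne_zero _ hU)
  have hric := hpair.riccati_next hX hDm hT hp
  have hDT : D T = D (potX D (ι X) (ι (C a)) (ι (C b)) u) := by
    have : D ((2 * (m : F) + 1) ^ 2) = 0 := by exact_mod_cast D.map_natCast ((2 * m + 1) ^ 2)
    rw [hTdef, map_add, this, add_zero]
  rw [← hDT] at hp
  have hlogU : D (ι U) = u * ι U := by rw [hu]; field_simp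
  have hlogU₀ : D (ι U₀) = (q + u) * ι U₀ := by rw [hq]; field_simp; ring
  have hlogT : D T = (p + q) * T := by rw [hp]; field_simp; ring
  -- `T U / U₀` is the expected value of `U_{m+1}/U_m`; `hric` makes it a solution of the same
  -- linear equation.
  have hg1 : D (T * ι U / ι U₀) = p * (T * ι U / ι U₀) := by
    rw [D.leibniz_div, D.leibniz, hlogU, hlogU₀, hlogT]
    simp only [smul_eq_mul]
    field_simp
    ring
  have hg2 : D (D (T * ι U / ι U₀)) = ((m : F) + 1) * (2 * ι X + 1) * D (T * ι U / ι U₀)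
      - 2 * D u * (T * ι U / ι U₀) := by
    rw [hg1, D.leibniz, hg1]
    simp only [smul_eq_mul]
    linear_combination (T * ι U / ι U₀) * hric
  -- The defect in the Toda equation; the hypotheses `hT0` and `hT1` make it vanish at `0` and `-1`.
  let R : ℂ[X] := N - U₀ * (Y₁ + Y₂)
  have hd : ι (U * U₀) ≠ 0 := by rw [map_mul]; exact mul_ne_zero hU hU₀
  have hRe : ι R / ι (U * U₀) = T * ι U / ι U₀ - ι Y₁ / ι U - ι Y₂ / ι U := by
    rw [hTN]
    simp only [R, map_sub, map_mul, map_add]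
    field_simp
    ring
  have hRode : D (D (ι R / ι (U * U₀))) = ((m : F) + 1) * (2 * ι X + 1) * D (ι R / ι (U * U₀))
      - 2 * D u * (ι R / ι (U * U₀)) := by
    rw [hRe]
    simp only [map_sub]
    rw [hg2, hode Y₁ (Or.inl rfl), hode Y₂ (Or.inr rfl)]
    ring
  have hYe : ∀ Y, ι (Y * U₀) / ι (U * U₀) = ι Y / ι U := fun Y => by
    simp only [map_mul]
    field_simp
  -- By Abel's identity the Wronskian has exponent `m` at `ζ`. It vanishes there to order at least
  -- `m + 1`: the factor `Y` gives at least order `m` after differentiation, and the zero of `R`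
  -- supplies one more where needed.
  have hW : ∀ Y, Y = Y₁ ∨ Y = Y₂ → ∀ ζ : ℂ, (ζ = 0 ∨ ζ = -1) → (X - C ζ) ^ (m + 1) ∣ Y →
      R * derivative (Y * U₀) - derivative R * (Y * U₀) = 0 := by
    intro Y hY ζ hζ hdvd
    have h1 := wronskian_equation hD hd hRode (S := Y * U₀) (by rw [hYe]; exact hode Y hY)
    have hN' : (derivative (X * (X + 1) : ℂ[X])).eval ζ = 2 * ζ + 1 := by
      simp
      ring
    have hR0 : R.eval ζ = 0 := by
      rcases hζ with rfl | rfl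
      · simp only [R, eval_sub, eval_mul]
        rw [hN0, ← hT0]
        ring
      · simp only [R, eval_sub, eval_mul]
        rw [hN1, ← hT1]
        ring
    have hζ0 : ζ * (ζ + 1) = 0 := by rcases hζ with rfl | rfl <;> norm_num
    refine Polynomial.eq_zero_of_indicial (N := X * (X + 1)) (ζ := ζ) (m := m) (by simpa using hζ0)
      ?_ ?_ ?_ h1 ?_
    · rw [hN']
      rcases hζ with rfl | rfl <;> norm_num
    · rw [eval_mul]
      rcases hζ with rfl | rfl
      · exact mul_ne_zero h10 h00
      · exact mul_ne_zero h11 h01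
    · rw [hN']
      simp only [eval_mul, eval_add, eval_X, eval_one, eval_natCast, eval_ofNat]
      linear_combination 2 * (eval ζ (derivative (U * U₀))) * hζ0
    · obtain ⟨Y', rfl⟩ := hdvd
      obtain ⟨R', hR'⟩ := dvd_iff_isRoot.mpr hR0
      rw [hR']
      refine ⟨R' * ((m + 1 : ℂ[X]) * (Y' * U₀) + (X - C ζ) * derivative (Y' * U₀)) -
        derivative ((X - C ζ) * R') * (Y' * U₀), ?_⟩
      simp only [derivative_mul, derivative_pow, derivative_sub, derivative_X, derivative_C,
        sub_zero, mul_one, Nat.add_sub_cancel, Nat.cast_add, Nat.cast_one, map_add, map_one,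
        map_natCast]
      ring
  have hY₁' : (X - C (-1 : ℂ)) ^ (m + 1) ∣ Y₁ := by simpa using hY₁
  have hY₂' : (X - C (0 : ℂ)) ^ (m + 1) ∣ Y₂ := by simpa using hY₂
  have hW1 := hW Y₁ (Or.inl rfl) (-1) (Or.inr rfl) hY₁'
  have hW2 := hW Y₂ (Or.inr rfl) 0 (Or.inl rfl) hY₂'
  have hY₂0 : Y₂.eval 0 = 0 := by
    obtain ⟨Y', rfl⟩ := hY₂
    simp
  have hY₁1 : Y₁.eval (-1) = 0 := by
    obtain ⟨Y', rfl⟩ := hY₁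
    simp
  -- A nonzero `R` would be proportional to both `Y₁` and `Y₂`. But `Y₂` vanishes at `0` and `Y₁`
  -- does not, so `Y₂ = 0`, contrary to its value at `-1`.
  have hR : R = 0 := by
    by_contra hR
    have h1 : (Y₁ * U₀) * derivative (Y₂ * U₀) = derivative (Y₁ * U₀) * (Y₂ * U₀) := by
      apply mul_left_cancel₀ hR
      linear_combination (Y₁ * U₀) * hW2 - (Y₂ * U₀) * hW1
    have h2 : Y₂ * U₀ = 0 := by
      refine Polynomial.eq_zero_of_indicial (N := X) (d := Y₁ * U₀)
        (E := X * derivative (Y₁ * U₀)) (ζ := 0) (m := 0) (by simp) (by simp) ?_ (by simp) ?_ ?_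
      · rw [eval_add, hY₂0, add_zero] at h20
        rw [eval_mul]
        exact mul_ne_zero h20 h00
      · linear_combination X * h1
      · rw [zero_add, pow_one]
        exact dvd_iff_isRoot.mpr (by simp [hY₂0])
    have h3 := congrArg (eval (-1)) h2
    rw [eval_add, hY₁1, zero_add] at h21
    rw [eval_mul, eval_zero] at h3
    exact mul_ne_zero h21 h01 h3
  have hToda : T * ι U ^ 2 = ι U₀ * ι (Y₁ + Y₂) := by
    have : N = U₀ * (Y₁ + Y₂) := sub_eq_zero.mp hR
    rw [hTN, this, map_mul]
    field_simp
  refine ⟨hT, ?_⟩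
  have hY : ι (Y₁ + Y₂) ≠ 0 := ne_of_eval h20
  have h1 := congrArg D hToda
  rw [D.leibniz, D.leibniz_pow, D.leibniz (ι U₀), hlogU, hlogU₀, hlogT] at h1
  simp only [smul_eq_mul, nsmul_eq_mul, Nat.cast_ofNat] at h1
  rw [div_eq_iff hY]
  apply mul_left_cancel₀ hU₀
  linear_combination -h1 + (p + 2 * u + q) * hToda

end FractionField

/-! ### The polynomials with `n = 0` for generic parameters. -/

/-- The product `∏_{j=1}^k (a + (2j-1)²)`. -/
def oddProd (a : ℂ) (k : ℕ) : ℂ := ∏ j ∈ Finset.range k, (a + (2 * (j : ℂ) + 1) ^ 2)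

/-- The generalized Umemura polynomial with indices `(0, m)` as a polynomial in `z²`. -/
def umemuraPoly (a b : ℂ) (m : ℕ) : ℂ[X] := solitonPoly (oddProd a) (oddProd b) m

/-- The predecessor of `umemuraPoly a b m`, with the convention that it is `1` for `m = 0`. -/
def umemuraPolyPred (a b : ℂ) : ℕ → ℂ[X]
  | 0 => 1
  | m + 1 => umemuraPoly a b m

theorem eval_zero_umemuraPoly (a b : ℂ) (m : ℕ) :
    (umemuraPoly a b m).eval 0 = ∏ i ∈ Finset.range m, oddProd b (i + 1) :=
  eval_zero_solitonPoly _ _ m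

theorem eval_neg_one_umemuraPoly (a b : ℂ) (m : ℕ) :
    (umemuraPoly a b m).eval (-1) = ∏ i ∈ Finset.range m, oddProd a (i + 1) :=
  eval_neg_one_solitonPoly _ _ m

theorem umemuraPoly_zero (a b : ℂ) : umemuraPoly a b 0 = 1 := by
  rw [umemuraPoly, solitonPoly, Fintype.sum_eq_single ∅ fun s hs =>
    (hs (Finset.eq_empty_of_isEmpty s)).elim]
  simp [crossRatio]

section FractionField

variable {F : Type*} [Field F] [CharZero F] [Algebra ℂ F] [Algebra ℂ[X] F]
  [IsFractionRing ℂ[X] F] {D : Derivation ℂ F F}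

local notation "ι" => algebraMap ℂ[X] F

/-- The Toda equation at `Z = 0`, and with `a` for `b` at `Z = -1`; `f m` is the value of the
predecessor. -/
theorem prod_oddProd_toda (b : ℂ) (m : ℕ) (f : ℕ → ℂ)
    (h0 : f 0 = 1) (hf : ∀ m, f (m + 1) = ∏ i ∈ Finset.range m, oddProd b (i + 1)) :
    (∏ i ∈ Finset.range (m + 1), oddProd b (i + 1)) * f m =
      (b + (2 * m + 1) ^ 2) * (∏ i ∈ Finset.range m, oddProd b (i + 1)) ^ 2 := by
  rcases m with _ | m
  · simp [h0, oddProd]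
  · rw [hf, Finset.prod_range_succ, Finset.prod_range_succ]
    have : oddProd b (m + 1 + 1) = oddProd b (m + 1) * (b + (2 * ((m + 1 : ℕ) : ℂ) + 1) ^ 2) := by
      rw [oddProd, oddProd, Finset.prod_range_succ]
    rw [this]
    ring

/-- Induction on `m`: `toda_equation` identifies `p` with `D log (U_{m+1}/U_m)`, and `TauPair.next`
transports the relations. Genericity keeps the values at `0` and `-1` nonzero. -/
theorem tauPair_umemuraPoly (hD : ∀ p : ℂ[X], D (ι p) = ι (X * (X + 1) * derivative p))
    {a b : ℂ} (ha : ∀ k, oddProd a k ≠ 0) (hb : ∀ k, oddProd b k ≠ 0) (m : ℕ) :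
    TauPair D (ι X) (ι (C a)) (ι (C b)) m (D (ι (umemuraPoly a b m)) / ι (umemuraPoly a b m))
      (D (ι (umemuraPolyPred a b m)) / ι (umemuraPolyPred a b m) -
        D (ι (umemuraPoly a b m)) / ι (umemuraPoly a b m)) := by
  have hX : D (ι X) = ι X * (ι X + 1) := by simp [hD]
  have hC : ∀ c : ℂ, D (ι (C c)) = 0 := fun c => by simp [hD]
  have hU0 : ∀ m, (umemuraPoly a b m).eval 0 ≠ 0 := fun m => by
    rw [eval_zero_umemuraPoly]
    exact Finset.prod_ne_zero_iff.mpr fun i _ => hb _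
  have hU1 : ∀ m, (umemuraPoly a b m).eval (-1) ≠ 0 := fun m => by
    rw [eval_neg_one_umemuraPoly]
    exact Finset.prod_ne_zero_iff.mpr fun i _ => ha _
  have hP0 : ∀ m, (umemuraPolyPred a b m).eval 0 ≠ 0 := fun m => by
    cases m
    · simp [umemuraPolyPred]
    · exact hU0 _
  have hP1 : ∀ m, (umemuraPolyPred a b m).eval (-1) ≠ 0 := fun m => by
    cases m
    · simp [umemuraPolyPred]
    · exact hU1 _
  induction m with
  | zero =>
    have h2 := TauPair.zero (D := D) (Z := ι X) hX (hC a) (hC b)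
    simpa [umemuraPoly_zero, umemuraPolyPred] using h2
  | succ m ih =>
    have hsplit : umemuraPoly a b (m + 1) =
        solitonPoly (Function.update (oddProd a) (m + 1) 0) (oddProd b) (m + 1) +
        solitonPoly (oddProd a) (Function.update (oddProd b) (m + 1) 0) (m + 1) :=
      solitonPoly_succ_eq_add _ _ m
    have hupd : ∀ (f : ℕ → ℂ), ∀ i < m, Function.update f (m + 1) 0 (i + 1) = f (i + 1) :=
      fun f i hi => Function.update_of_ne (by omega) _ _
    have hne : umemuraPoly a b m ≠ 0 := fun h => hU0 m (by rw [h, eval_zero])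
    have h3 := toda_equation hD a b m (hP0 m) (hP1 m) (hU0 m) (hU1 m)
      (by rw [← hsplit]; exact hU0 _) (by rw [← hsplit]; exact hU1 _)
      (by
        rw [← hsplit, eval_zero_umemuraPoly, eval_zero_umemuraPoly]
        exact prod_oddProd_toda b m (fun m => (umemuraPolyPred a b m).eval 0)
          (by simp [umemuraPolyPred]) (fun m => eval_zero_umemuraPoly a b m))
      (by
        rw [← hsplit, eval_neg_one_umemuraPoly, eval_neg_one_umemuraPoly]
        exact prod_oddProd_toda a m (fun m => (umemuraPolyPred a b m).eval (-1))
          (by simp [umemuraPolyPred]) (fun m => eval_neg_one_umemuraPoly a b m))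
      (X_add_one_pow_dvd_solitonPoly _ _ m (by simp)) (X_pow_dvd_solitonPoly _ _ m (by simp))
      rfl rfl ih rfl (by
        -- Setting the coefficient of index `m + 1` to zero does not change `U_m`, so each part
        -- satisfies the same linear equation.
        rintro Y (rfl | rfl)
        · have e : umemuraPoly a b m =
              solitonPoly (Function.update (oddProd a) (m + 1) 0) (oddProd b) m :=
            solitonPoly_congr (fun i hi => (hupd _ i hi).symm) (fun i _ => rfl)
          rw [e] at hne ⊢
          exact solitonPoly_schrodinger hD _ _ m hne _ _ rfl rfl
        · have e : umemuraPoly a b m =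
              solitonPoly (oddProd a) (Function.update (oddProd b) (m + 1) 0) m :=
            solitonPoly_congr (fun i _ => rfl) (fun i hi => (hupd _ i hi).symm)
          rw [e] at hne ⊢
          exact solitonPoly_schrodinger hD _ _ m hne _ _ rfl rfl)
    rw [← hsplit] at h3
    have h4 := ih.next hX (D.map_natCast m) (hC a) (hC b) h3.1 rfl
    rw [← h3.2] at h4
    have h5 : umemuraPolyPred a b (m + 1) = umemuraPoly a b m := rfl
    rw [h5]
    push_cast
    convert! h4 using 1
    rw [h3.2]
    ring

/-- `TauPair.cubic` multiplied by `U⁶`. In this polynomial form it also makes sense for parameters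
at which the induction breaks down. -/
theorem umemuraPoly_cubic_of_derivation
    (hD : ∀ p : ℂ[X], D (ι p) = ι (X * (X + 1) * derivative p))
    {a b : ℂ} (ha : ∀ k, oddProd a k ≠ 0) (hb : ∀ k, oddProd b k ≠ 0) (m : ℕ) (U : ℂ[X])
    (hU : U = umemuraPoly a b m) :
    4 * numDX a b U ^ 2 + numX a b U * (numP a b U * U - (2 * X + 1) * numX a b U) ^ 2 =
      4 * (X * (X + 1)) * (numX a b U - C a * U ^ 2) * (numX a b U - C b * U ^ 2) *
        (numX a b U + (2 * (m : ℂ[X]) + 1) ^ 2 * U ^ 2) := by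
  have hinj : Function.Injective ι := IsFractionRing.injective ℂ[X] F
  have hU0 : ι U ≠ 0 := by
    rw [map_ne_zero_iff _ hinj, hU]
    intro h
    have h1 := eval_zero_umemuraPoly a b m
    rw [h, eval_zero] at h1
    exact Finset.prod_ne_zero_iff.mpr (fun i _ => hb _) h1.symm
  have h := (tauPair_umemuraPoly hD ha hb m).cubic
  rw [← hU, potQ, deriv_potX_eq_div hD a b hU0, potX_eq_div hD a b hU0,
    potP_eq_div hD a b hU0] at h
  apply hinj
  simp only [map_add, map_mul, map_sub, map_pow, map_one, map_ofNat, map_natCast]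
  field_simp at h
  linear_combination h

end FractionField

/-! ### Removing genericity by continuity. -/

/-- A family of polynomials whose coefficients are continuous functions of the parameter. -/
def CoeffContinuous (p : ℂ → ℂ[X]) : Prop := ∀ n, Continuous fun x => (p x).coeff n

namespace CoeffContinuous

variable {p q : ℂ → ℂ[X]}

theorem const (r : ℂ[X]) : CoeffContinuous fun _ => r := fun _ => continuous_const

theorem ofContinuous {f : ℂ → ℂ} (hf : Continuous f) : CoeffContinuous fun x => C (f x) := by
  intro n
  simp only [coeff_C]
  split_ifs
  · exact hf
  · exact continuous_const

theorem add (hp : CoeffContinuous p) (hq : CoeffContinuous q) :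
    CoeffContinuous fun x => p x + q x := fun n => by
  simp only [coeff_add]
  exact (hp n).add (hq n)

theorem sub (hp : CoeffContinuous p) (hq : CoeffContinuous q) :
    CoeffContinuous fun x => p x - q x := fun n => by
  simp only [coeff_sub]
  exact (hp n).sub (hq n)

theorem mul (hp : CoeffContinuous p) (hq : CoeffContinuous q) :
    CoeffContinuous fun x => p x * q x := fun n => by
  simp only [coeff_mul]
  exact continuous_finsetSum _ fun i _ => (hp _).mul (hq _)

theorem pow (hp : CoeffContinuous p) (k : ℕ) : CoeffContinuous fun x => p x ^ k := by
  induction k with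
  | zero => simpa using const 1
  | succ k ih => simpa only [pow_succ] using ih.mul hp

theorem deriv (hp : CoeffContinuous p) : CoeffContinuous fun x => derivative (p x) := fun n => by
  simp only [coeff_derivative]
  exact (hp _).mul continuous_const

theorem sum {ι : Type*} (s : Finset ι) {f : ι → ℂ → ℂ[X]} (h : ∀ i ∈ s, CoeffContinuous (f i)) :
    CoeffContinuous fun x => ∑ i ∈ s, f i x := fun n => by
  simp only [finsetSum_coeff]
  exact continuous_finsetSum _ fun i hi => h i hi n

theorem prod {ι : Type*} (s : Finset ι) {f : ι → ℂ → ℂ[X]} (h : ∀ i ∈ s, CoeffContinuous (f i)) :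
    CoeffContinuous fun x => ∏ i ∈ s, f i x := by
  classical
  induction s using Finset.induction_on with
  | empty => simpa using const 1
  | insert i s hi ih =>
    simp only [Finset.prod_insert hi]
    exact (h i (by simp)).mul (ih fun j hj => h j (Finset.mem_insert_of_mem hj))

theorem eq_of_dense (hp : CoeffContinuous p) (hq : CoeffContinuous q) {s : Set ℂ} (hs : Dense s)
    (h : ∀ x ∈ s, p x = q x) (x : ℂ) : p x = q x := by
  ext n
  exact congrFun (Continuous.ext_on hs (hp n) (hq n) fun y hy => by simp only [h y hy]) x

end CoeffContinuous

theorem continuous_oddProd_add (a : ℂ) (k : ℕ) : Continuous fun x => oddProd (a + x) k := by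
  unfold oddProd
  fun_prop

theorem coeffContinuous_umemuraPoly (a b : ℂ) (m : ℕ) :
    CoeffContinuous fun x => umemuraPoly (a + x) (b + x) m := by
  simp only [umemuraPoly, solitonPoly]
  refine CoeffContinuous.sum _ fun s _ => (CoeffContinuous.const _).mul
    ((CoeffContinuous.prod _ fun i _ => (CoeffContinuous.const _).mul (CoeffContinuous.mul ?_
      (CoeffContinuous.const _))).mul
    (CoeffContinuous.prod _ fun i _ => CoeffContinuous.mul ?_ (CoeffContinuous.const _)))
  · exact CoeffContinuous.ofContinuous (continuous_oddProd_add a _)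
  · exact CoeffContinuous.ofContinuous (continuous_oddProd_add b _)

/-- Shifting both parameters by the same `x` suffices: only countably many `x` are bad. -/
theorem dense_oddProd_ne_zero (a b : ℂ) :
    Dense {x : ℂ | (∀ k, oddProd (a + x) k ≠ 0) ∧ ∀ k, oddProd (b + x) k ≠ 0} := by
  have h : ((Set.range fun j : ℕ => -a - (2 * (j : ℂ) + 1) ^ 2) ∪
      Set.range fun j : ℕ => -b - (2 * (j : ℂ) + 1) ^ 2).Countable :=
    (Set.countable_range _).union (Set.countable_range _)
  refine (h.dense_compl ℝ).mono fun x hx => ?_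
  simp only [Set.mem_compl_iff, Set.mem_union, Set.mem_range, not_or, not_exists] at hx
  refine ⟨fun k => Finset.prod_ne_zero_iff.mpr fun j _ h0 => hx.1 j ?_,
    fun k => Finset.prod_ne_zero_iff.mpr fun j _ h0 => hx.2 j ?_⟩
  · linear_combination -h0
  · linear_combination -h0

/-- The polynomial form of the equation satisfied by the Umemura polynomials. -/
theorem umemuraPoly_cubic (a b : ℂ) (m : ℕ) (U : ℂ[X]) (hU : U = umemuraPoly a b m) :
    4 * numDX a b U ^ 2 + numX a b U * (numP a b U * U - (2 * X + 1) * numX a b U) ^ 2 =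
      4 * (X * (X + 1)) * (numX a b U - C a * U ^ 2) * (numX a b U - C b * U ^ 2) *
        (numX a b U + (2 * (m : ℂ[X]) + 1) ^ 2 * U ^ 2) := by
  have := (IsFractionRing.injective ℂ[X] (FractionRing ℂ[X]))
  have : CharZero (FractionRing ℂ[X]) := charZero_of_injective_algebraMap this
  obtain ⟨D, hD⟩ := Derivation.exists_extension_fractionField (K := FractionRing ℂ[X])
    ((X * (X + 1) : ℂ[X]) • (derivative' : Derivation ℂ ℂ[X] ℂ[X]))
  have hfam := coeffContinuous_umemuraPoly a b m
  have hC : ∀ c : ℂ, CoeffContinuous fun x => C (c + x) := fun c =>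
    CoeffContinuous.ofContinuous (continuous_const.add continuous_id)
  have hP : CoeffContinuous fun x => numP (a + x) (b + x) (umemuraPoly (a + x) (b + x) m) :=
    ((((hC a).mul (.const _)).add ((hC b).mul (.const _))).mul hfam).sub
      ((CoeffContinuous.const _).mul hfam.deriv)
  have hX : CoeffContinuous fun x => numX (a + x) (b + x) (umemuraPoly (a + x) (b + x) m) :=
    (((CoeffContinuous.const _).mul hP).mul hfam).sub
      ((CoeffContinuous.const _).mul ((hP.deriv.mul hfam).sub (hP.mul hfam.deriv)))
  have hDX : CoeffContinuous fun x => numDX (a + x) (b + x) (umemuraPoly (a + x) (b + x) m) :=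
    (CoeffContinuous.const _).mul ((hX.deriv.mul hfam).sub
      (((CoeffContinuous.const _).mul hX).mul hfam.deriv))
  have key := CoeffContinuous.eq_of_dense
    (((CoeffContinuous.const 4).mul (hDX.pow 2)).add
      (hX.mul (((hP.mul hfam).sub ((CoeffContinuous.const (2 * X + 1)).mul hX)).pow 2)))
    ((((CoeffContinuous.const (4 * (X * (X + 1)))).mul (hX.sub ((hC a).mul (hfam.pow 2)))).mul
      (hX.sub ((hC b).mul (hfam.pow 2)))).mul
      (hX.add ((CoeffContinuous.const ((2 * (m : ℂ[X]) + 1) ^ 2)).mul (hfam.pow 2))))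
    (dense_oddProd_ne_zero a b)
    (fun x hx => umemuraPoly_cubic_of_derivation (fun p => hD p) hx.1 hx.2 m _ rfl) 0
  simpa only [add_zero, ← hU] using key

/-! ### Reduction of `U_{n,m}` to the case `n = 0`. -/

namespace GenUmemura

open Finset

theorem parityProd_two_mul (a : ℂ) (k : ℕ) : parityProd a (2 * k) = oddProd a k := by
  have h : (Icc 1 (2 * k)).filter (fun j => j % 2 = 2 * k % 2) =
      (range k).image (fun j => 2 * j + 2) := by
    ext j
    simp only [mem_filter, mem_Icc, mem_image, mem_range]
    constructor
    · rintro ⟨⟨h1, h2⟩, h3⟩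
      exact ⟨j / 2 - 1, by omega, by omega⟩
    · rintro ⟨i, hi, rfl⟩
      omega
  rw [parityProd, h, prod_image (by intro i _ j _ hij; simpa using hij), oddProd]
  refine prod_congr rfl fun j _ => ?_
  push_cast
  ring

theorem parityProd_zero_odd (j : ℕ) : parityProd 0 (2 * j + 1) = 0 := by
  refine prod_eq_zero (i := 1) ?_ (by simp)
  simp only [mem_filter, mem_Icc]
  omega

/-- The factors of `oddProd (-4M²) k` are `(2j+1-2M)(2j+1+2M)`, so the quotient for `M + 1` and `M`
telescopes. -/
theorem sub_mul_oddProd_succ (M : ℂ) (k : ℕ) :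
    (2 * k - 2 * M - 1) * oddProd (-4 * (M + 1) ^ 2) k =
      -(2 * k + 2 * M + 1) * oddProd (-4 * M ^ 2) k := by
  induction k with
  | zero =>
    simp [oddProd]
    ring
  | succ k ih =>
    have h : ∀ a : ℂ, oddProd a (k + 1) = oddProd a k * (a + (2 * (k : ℂ) + 1) ^ 2) := fun a => by
      rw [oddProd, oddProd, prod_range_succ]
    rw [h, h]
    push_cast
    linear_combination (2 * k + 2 * M + 3) * (2 * k + 1 - 2 * M) * ih

/-- The cross factors between `2k` and the odd numbers below `2M` turn the parameter `0` into
`-4M²`. The truncated `k - M` is the exponent that `2k` contributes to `c(I)`; together with the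
absolute values it yields the uniform sign `(-1)^k`. -/
theorem sign_mul_prod_mul_oddProd (M k : ℕ) :
    (-1) ^ (k - M) * ((∏ j ∈ range M, |(((2 * k : ℕ) : ℚ) + ((2 * j + 1 : ℕ) : ℚ)) /
      (((2 * k : ℕ) : ℚ) - ((2 * j + 1 : ℕ) : ℚ))| : ℚ) : ℂ) * oddProd 0 k =
      (-1) ^ k * oddProd (-4 * (M : ℂ) ^ 2) k := by
  induction M with
  | zero => simp
  | succ M ih =>
    have hne : (2 * (k : ℂ) - 2 * M - 1) ≠ 0 := by
      have : ((2 * k - 2 * M - 1 : ℤ) : ℂ) ≠ 0 := by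
        rw [Int.cast_ne_zero]
        omega
      exact_mod_cast this
    have hsign : (-1 : ℂ) ^ (k - (M + 1)) * ((|(((2 * k : ℕ) : ℚ) + ((2 * M + 1 : ℕ) : ℚ)) /
        (((2 * k : ℕ) : ℚ) - ((2 * M + 1 : ℕ) : ℚ))| : ℚ) : ℂ)
        = (-1) ^ (k - M) * (-(2 * k + 2 * M + 1) / (2 * k - 2 * M - 1)) := by
      rw [abs_div, abs_of_nonneg (by positivity)]
      rcases Nat.lt_or_ge M k with h | h
      · have h1 : k - M = k - (M + 1) + 1 := by omega
        have h2 : (M : ℚ) + 1 ≤ k := by exact_mod_cast h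
        rw [h1, pow_succ, abs_of_nonneg (by push_cast; linarith)]
        push_cast
        rw [sub_add_eq_sub_sub]
        field_simp
        ring
      · have h1 : k - (M + 1) = 0 := by omega
        have h2 : k - M = 0 := by omega
        have h3 : (k : ℚ) ≤ M := by exact_mod_cast h
        rw [h1, h2, abs_of_nonpos (by push_cast; linarith)]
        push_cast
        rw [sub_add_eq_sub_sub, pow_zero, one_mul, one_mul, div_neg, neg_div]
        ring
    rw [prod_range_succ]
    push_cast only [Rat.cast_mul]
    have h4 := sub_mul_oddProd_succ M k
    calc _ = ((-1 : ℂ) ^ (k - (M + 1)) * ((|(((2 * k : ℕ) : ℚ) + ((2 * M + 1 : ℕ) : ℚ)) /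
          (((2 * k : ℕ) : ℚ) - ((2 * M + 1 : ℕ) : ℚ))| : ℚ) : ℂ)) *
          ((∏ j ∈ range M, |(((2 * k : ℕ) : ℚ) + ((2 * j + 1 : ℕ) : ℚ)) /
          (((2 * k : ℕ) : ℚ) - ((2 * j + 1 : ℕ) : ℚ))| : ℚ) : ℂ) * oddProd 0 k := by ring
      _ = (-(2 * k + 2 * M + 1) / (2 * k - 2 * M - 1)) *
          ((-1) ^ k * oddProd (-4 * (M : ℂ) ^ 2) k) := by rw [hsign, ← ih]; ring
      _ = _ := by
        rw [div_mul_eq_mul_div, div_eq_iff hne]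
        push_cast
        linear_combination -(-1) ^ k * h4

/-- The doubling map onto the positive even numbers. -/
def evenEmb (m : ℕ) : Fin m ↪ ℕ := ⟨fun i => 2 * ((i : ℕ) + 1), fun i j h => by
  simp only at h
  exact Fin.ext (by omega)⟩

@[simp]
theorem evenEmb_apply (m : ℕ) (i : Fin m) : evenEmb m i = 2 * ((i : ℕ) + 1) := rfl

/-- If the odd elements of the index set do not contribute to the first variable, then the
polynomial reduces to a sum over the sets of even elements. -/
theorem umemura_eq_sum (n m μ M : ℕ) (z w a b : ℂ)
    (hS : indexSet n m = univ.map (evenEmb μ) ∪ (range M).image (fun j => 2 * j + 1))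
    (hsgn : ∀ k, 1 ≤ k → k ≤ μ → (if n < 2 * k then (2 * k - n) / 2 else 0) = k - M)
    (ha : ∀ j < M, parityProd a (2 * j + 1) = 0) :
    umemura n m z w a b = ((∏ j ∈ range M, parityProd b (2 * j + 1)) * w ^ M ^ 2) *
      ∑ s : Finset (Fin μ), ((crossRatio s : ℚ) : ℂ) *
        ((∏ i ∈ s, ((-1) ^ ((i : ℕ) + 1 - M) *
          ((∏ j ∈ range M, |(((2 * (i + 1) : ℕ) : ℚ) + ((2 * j + 1 : ℕ) : ℚ)) /
            (((2 * (i + 1) : ℕ) : ℚ) - ((2 * j + 1 : ℕ) : ℚ))| : ℚ) : ℂ) * oddProd a (i + 1)) *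
            (z ^ 2) ^ ((i : ℕ) + 1)) *
        ∏ i ∈ sᶜ, oddProd b (i + 1) * (w ^ 2) ^ ((i : ℕ) + 1)) := by
  classical
  rw [umemura, mul_sum]
  symm
  set O : Finset ℕ := (range M).image (fun j => 2 * j + 1) with hO
  have hev : ∀ x (t : Finset (Fin μ)), x ∈ t.map (evenEmb μ) → x % 2 = 0 := by
    intro x t hx
    obtain ⟨i, _, rfl⟩ := mem_map.mp hx
    simp
  have hod : ∀ x ∈ O, x % 2 = 1 := by
    intro x hx
    obtain ⟨i, _, rfl⟩ := mem_image.mp hx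
    omega
  have hinjO : Set.InjOn (fun j => 2 * j + 1) (range M : Set ℕ) := by
    intro i _ j _ hij
    simpa using hij
  have hdisj : ∀ t : Finset (Fin μ), Disjoint (t.map (evenEmb μ)) O := fun t =>
    disjoint_left.mpr fun x h1 h2 => by
      have := hev x t h1
      have := hod x h2
      omega
  refine sum_of_injOn (fun s : Finset (Fin μ) => s.map (evenEmb μ))
    ((map_injective (evenEmb μ)).injOn) ?_ ?_ ?_
  · intro s _
    simp only [coe_powerset, Set.mem_preimage, Set.mem_powerset_iff, coe_subset, hS]
    exact (map_subset_map.mpr (subset_univ s)).trans subset_union_left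
  -- A set that is not the image of some `s` contains an odd element, for which `a_i = 0`.
  · intro I hI hnot
    have hex : ∃ x ∈ I, x ∈ O := by
      by_contra hno
      push Not at hno
      apply hnot
      have hsub : I ⊆ univ.map (evenEmb μ) := by
        intro x hx
        have := mem_powerset.mp hI hx
        rw [hS] at this
        exact (mem_union.mp this).resolve_right (hno x hx)
      obtain ⟨u, _, rfl⟩ := subset_map_iff.mp hsub
      exact ⟨u, by simp, rfl⟩
    obtain ⟨x, hx, hxO⟩ := hex
    obtain ⟨j, hj, rfl⟩ := mem_image.mp hxO
    rw [prod_eq_zero hx (ha j (mem_range.mp hj))]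
    simp
  · intro s _
    have hcompl : indexSet n m \ s.map (evenEmb μ) = sᶜ.map (evenEmb μ) ∪ O := by
      rw [hS]
      ext x
      simp only [mem_sdiff, mem_union, mem_map, mem_univ, true_and, mem_compl]
      constructor
      · rintro ⟨⟨i, rfl⟩ | h, h2⟩
        · exact Or.inl ⟨i, fun hi => h2 ⟨i, hi, rfl⟩, rfl⟩
        · exact Or.inr h
      · rintro (⟨i, hi, rfl⟩ | h)
        · refine ⟨Or.inl ⟨i, rfl⟩, ?_⟩
          rintro ⟨j, hj, hij⟩
          exact hi ((evenEmb μ).injective hij ▸ hj)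
        · refine ⟨Or.inr h, ?_⟩
          rintro ⟨j, hj, rfl⟩
          exact disjoint_left.mp (hdisj s) (mem_map_of_mem _ hj) h
    have hd : (dNum n m (s.map (evenEmb μ)) : ℚ) = crossRatio s *
        ∏ i ∈ s, ∏ j ∈ range M, |(((2 * (i + 1) : ℕ) : ℚ) + ((2 * j + 1 : ℕ) : ℚ)) /
            (((2 * (i + 1) : ℕ) : ℚ) - ((2 * j + 1 : ℕ) : ℚ))| := by
      rw [dNum, hcompl, prod_map, crossRatio, ← prod_mul_distrib]
      refine prod_congr rfl fun i _ => ?_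
      rw [prod_union (hdisj _), prod_map, hO, prod_image hinjO]
      congr 1
      refine prod_congr rfl fun j _ => ?_
      simp only [evenEmb_apply]
      push_cast
      rw [abs_div, abs_of_nonneg (by positivity), ← mul_add, ← mul_sub, abs_mul, abs_two,
        mul_div_mul_left _ _ two_ne_zero]
      congr 2
      ring
    have hc : (-1 : ℂ) ^ cNum n (s.map (evenEmb μ)) = ∏ i ∈ s, (-1) ^ ((i : ℕ) + 1 - M) := by
      rw [cNum, sum_filter, sum_map, prod_pow_eq_pow_sum]
      congr 1
      refine sum_congr rfl fun i _ => ?_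
      exact hsgn (i + 1) (by omega) (by omega)
    -- The sum of the first `M` odd numbers is the exponent of the extra power of `w`.
    have hsumO : ∑ i ∈ O, i = M ^ 2 := by
      rw [hO, sum_image hinjO]
      clear hS hsgn ha hO hod hinjO hdisj hcompl hd hc
      induction M with
      | zero => simp
      | succ M ih => rw [sum_range_succ, ih]; ring
    rw [hd, hc, hcompl, prod_union (hdisj _), sum_union (hdisj _), hsumO, prod_map, prod_map,
      sum_map, sum_map, hO, prod_image hinjO, pow_add w, ← prod_pow_eq_pow_sum,
      ← prod_pow_eq_pow_sum]
    simp only [evenEmb_apply, parityProd_two_mul, pow_mul, prod_mul_distrib]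
    push_cast
    ring

theorem umemura_eq_eval (n m μ M : ℕ) (z w a a' b : ℂ) (hw : w ^ 2 = z ^ 2 + 1)
    (hS : indexSet n m = univ.map (evenEmb μ) ∪ (range M).image (fun j => 2 * j + 1))
    (hsgn : ∀ k, 1 ≤ k → k ≤ μ → (if n < 2 * k then (2 * k - n) / 2 else 0) = k - M)
    (ha : ∀ j < M, parityProd a (2 * j + 1) = 0)
    (haa' : ∀ k, (-1) ^ (k - M) * ((∏ j ∈ range M, |(((2 * k : ℕ) : ℚ) + ((2 * j + 1 : ℕ) : ℚ)) /
      (((2 * k : ℕ) : ℚ) - ((2 * j + 1 : ℕ) : ℚ))| : ℚ) : ℂ) * oddProd a k =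
      (-1) ^ k * oddProd a' k) :
    umemura n m z w a b = ((∏ j ∈ range M, parityProd b (2 * j + 1)) * w ^ M ^ 2) *
      (umemuraPoly a' b μ).eval (z ^ 2) := by
  rw [umemura_eq_sum n m μ M z w a b hS hsgn ha, umemuraPoly, solitonPoly, eval_finsetSum]
  congr 1
  refine sum_congr rfl fun s _ => ?_
  simp only [haa', eval_mul, eval_prod, eval_C, eval_pow, eval_X, eval_add, eval_one, eval_neg, hw,
    mul_assoc]

theorem umemura_zero (m : ℕ) (z w a b : ℂ) (hw : w ^ 2 = z ^ 2 + 1) :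
    umemura 0 m z w a b = (umemuraPoly a b m).eval (z ^ 2) := by
  have h := umemura_eq_eval 0 m m 0 z w a a b hw ?_ ?_ (by simp) (by simp)
  · simpa using h
  · ext x
    simp only [indexSet, evenEmb_apply, mem_union, mem_Icc, mem_image, mem_map, mem_univ, true_and,
      range_zero, image_empty, notMem_empty, or_false]
    constructor
    · rintro (h | ⟨j, hj, rfl⟩)
      · omega
      · exact ⟨⟨j - 1, by omega⟩, by simp only; omega⟩
    · rintro ⟨i, rfl⟩
      exact Or.inr ⟨i + 1, by omega, by omega⟩
  · intro k h1 h2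
    rw [if_pos (by omega)]
    omega

/-- Here `[2ν;m]` consists of the even numbers up to `2(ν+m)` and the odd numbers below `2ν`. -/
theorem umemura_even (ν m : ℕ) (z w b : ℂ) (hw : w ^ 2 = z ^ 2 + 1) :
    umemura (2 * ν) m z w 0 b = ((∏ j ∈ range ν, parityProd b (2 * j + 1)) * w ^ ν ^ 2) *
      (umemuraPoly (-4 * (ν : ℂ) ^ 2) b (ν + m)).eval (z ^ 2) := by
  refine umemura_eq_eval (2 * ν) m (ν + m) ν z w 0 _ b hw ?_ ?_
    (fun j _ => parityProd_zero_odd j) (sign_mul_prod_mul_oddProd ν)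
  · ext x
    simp only [indexSet, evenEmb_apply, mem_union, mem_Icc, mem_image, mem_map, mem_univ, true_and,
      mem_range]
    constructor
    · rintro (h | ⟨j, hj, rfl⟩)
      · rcases Nat.even_or_odd' x with ⟨c, hc | hc⟩
        · exact Or.inl ⟨⟨c - 1, by omega⟩, by simp only; omega⟩
        · exact Or.inr ⟨c, by omega, by omega⟩
      · exact Or.inl ⟨⟨ν + j - 1, by omega⟩, by simp only; omega⟩
    · rintro (⟨i, rfl⟩ | ⟨j, hj, rfl⟩)
      · by_cases h : (i : ℕ) + 1 ≤ ν
        · exact Or.inl (by omega)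
        · exact Or.inr ⟨i + 1 - ν, by omega, by omega⟩
      · exact Or.inl (by omega)
  · intro k h1 h2
    split_ifs <;> omega

/-- The tail is now odd: the even numbers stop at `2ν`, the odd ones at `2(ν+m)+1`. No even element
exceeds `n`, so the signs come only from the cross factors. -/
theorem umemura_odd (ν m : ℕ) (z w b : ℂ) (hw : w ^ 2 = z ^ 2 + 1) :
    umemura (2 * ν + 1) m z w 0 b =
      ((∏ j ∈ range (ν + m + 1), parityProd b (2 * j + 1)) * w ^ (ν + m + 1) ^ 2) *
      (umemuraPoly (-4 * ((ν + m + 1 : ℕ) : ℂ) ^ 2) b ν).eval (z ^ 2) := by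
  refine umemura_eq_eval (2 * ν + 1) m ν (ν + m + 1) z w 0 _ b hw ?_ ?_
    (fun j _ => parityProd_zero_odd j) (sign_mul_prod_mul_oddProd (ν + m + 1))
  · ext x
    simp only [indexSet, evenEmb_apply, mem_union, mem_Icc, mem_image, mem_map, mem_univ, true_and,
      mem_range]
    constructor
    · rintro (h | ⟨j, hj, rfl⟩)
      · rcases Nat.even_or_odd' x with ⟨c, hc | hc⟩
        · exact Or.inl ⟨⟨c - 1, by omega⟩, by simp only; omega⟩
        · exact Or.inr ⟨c, by omega, by omega⟩
      · exact Or.inr ⟨ν + j, by omega, by omega⟩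
    · rintro (⟨i, rfl⟩ | ⟨j, hj, rfl⟩)
      · exact Or.inl (by omega)
      · by_cases h : j ≤ ν
        · exact Or.inl (by omega)
        · exact Or.inr ⟨j - ν, by omega, by omega⟩
  · intro k h1 h2
    rw [if_neg (by omega)]
    omega

end GenUmemura

/-! ### Change of variable from `Z = z²` to `t`. -/

namespace GenUmemura

open Filter Topology

namespace AreBranches

variable {Ω : Set ℂ} {r s z w : ℂ → ℂ} (h : AreBranches Ω r s z w) {t : ℂ} (ht : t ∈ Ω)

include h ht

theorem r_ne_zero : r t ≠ 0 := fun h0 => h.zero_notMem (by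
  have := h.r_sq t ht
  rw [h0] at this
  simpa [← this] using ht)

theorem s_ne_zero : s t ≠ 0 := fun h0 => h.one_notMem (by
  have := h.s_sq t ht
  rw [h0] at this
  have h1 : t = 1 := by linear_combination -this
  rwa [h1] at ht)

theorem sq_sub_sq : (r t - s t) * (r t + s t) = 1 := by
  linear_combination h.r_sq t ht - h.s_sq t ht

theorem z_sq_eq : z t ^ 2 = (r t - s t) ^ 2 / (4 * (r t * s t)) := by
  have hr := h.r_ne_zero ht
  have hs := h.s_ne_zero ht
  have h1 : z t ^ 2 = (r t / s t + s t / r t - 2) / 4 := by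
    rw [← h.z_sq t ht]; ring
  rw [h1]
  field_simp
  ring

theorem w_sq_eq : w t ^ 2 = (r t + s t) ^ 2 / (4 * (r t * s t)) := by
  have hr := h.r_ne_zero ht
  have hs := h.s_ne_zero ht
  have h1 : w t ^ 2 = (r t / s t + s t / r t + 2) / 4 := by
    rw [← h.w_sq t ht]; ring
  rw [h1]
  field_simp
  ring

theorem w_sq_eq_z_sq_add_one : w t ^ 2 = z t ^ 2 + 1 := by
  have hr := h.r_ne_zero ht
  have hs := h.s_ne_zero ht
  rw [h.w_sq_eq ht, h.z_sq_eq ht]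
  field_simp
  ring

theorem w_ne_zero : w t ≠ 0 := by
  intro h0
  have hr := h.r_ne_zero ht
  have hs := h.s_ne_zero ht
  have h1 := h.w_sq_eq ht
  have h2 := h.sq_sub_sq ht
  rw [h0, eq_div_iff (by simp [hr, hs])] at h1
  have h3 : r t + s t = 0 := by simpa using h1.symm
  rw [h3] at h2
  simp at h2

theorem sixteen_mul : 16 * (z t ^ 2 * (z t ^ 2 + 1)) * (r t * s t) ^ 2 = 1 := by
  have hr := h.r_ne_zero ht
  have hs := h.s_ne_zero ht
  rw [← h.w_sq_eq_z_sq_add_one ht, h.w_sq_eq ht, h.z_sq_eq ht]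
  field_simp
  linear_combination 16 * ((r t - s t) * (r t + s t) + 1) * h.sq_sub_sq ht

theorem two_mul_sub_one : 2 * t - 1 = (2 * z t ^ 2 + 1) * (2 * (r t * s t)) := by
  have hr := h.r_ne_zero ht
  have hs := h.s_ne_zero ht
  rw [h.z_sq_eq ht]
  field_simp
  linear_combination -4 * h.r_sq t ht - 4 * h.s_sq t ht

theorem mul_sub_one : t * (t - 1) = (r t * s t) ^ 2 := by
  rw [mul_pow, h.r_sq t ht, h.s_sq t ht]

theorem hasDerivAt_r : HasDerivAt r (1 / (2 * r t)) t := by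
  have hr := h.r_ne_zero ht
  have hn : Ω ∈ 𝓝 t := h.isOpen.mem_nhds ht
  have h1 : HasDerivAt r (deriv r t) t := (h.r_holo.differentiableAt hn).hasDerivAt
  have h2 : HasDerivAt (fun x => r x ^ 2) 1 t :=
    (hasDerivAt_id t).congr_of_eventuallyEq (by filter_upwards [hn] with x hx using h.r_sq x hx)
  have h3 := (h1.pow 2).unique h2
  have h4 : deriv r t = 1 / (2 * r t) := by
    rw [eq_div_iff (by simpa using hr)]
    simp at h3
    linear_combination h3
  rwa [h4] at h1

theorem hasDerivAt_s : HasDerivAt s (1 / (2 * s t)) t := by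
  have hs := h.s_ne_zero ht
  have hn : Ω ∈ 𝓝 t := h.isOpen.mem_nhds ht
  have h1 : HasDerivAt s (deriv s t) t := (h.s_holo.differentiableAt hn).hasDerivAt
  have h2 : HasDerivAt (fun x => s x ^ 2) 1 t :=
    ((hasDerivAt_id t).sub_const 1).congr_of_eventuallyEq
      (by filter_upwards [hn] with x hx using h.s_sq x hx)
  have h3 := (h1.pow 2).unique h2
  have h4 : deriv s t = 1 / (2 * s t) := by
    rw [eq_div_iff (by simpa using hs)]
    simp at h3
    linear_combination h3
  rwa [h4] at h1

theorem hasDerivAt_mul : HasDerivAt (fun x => r x * s x) ((2 * z t ^ 2 + 1)) t := by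
  have hr := h.r_ne_zero ht
  have hs := h.s_ne_zero ht
  convert! (h.hasDerivAt_r ht).mul (h.hasDerivAt_s ht) using 1
  rw [h.z_sq_eq ht]
  field_simp
  ring

/-- Together with `sixteen_mul` this says `t(t-1) d/dt = -2 r s D`, where `D = Z(Z+1) d/dZ`. -/
theorem hasDerivAt_z_sq : HasDerivAt (fun x => z x ^ 2) (-1 / (8 * (r t * s t) ^ 3)) t := by
  have hr := h.r_ne_zero ht
  have hs := h.s_ne_zero ht
  have hn : Ω ∈ 𝓝 t := h.isOpen.mem_nhds ht
  have h1 : HasDerivAt (fun x => (r x - s x) ^ 2 / (4 * (r x * s x))) _ t :=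
    (((h.hasDerivAt_r ht).sub (h.hasDerivAt_s ht)).pow 2).div
      ((h.hasDerivAt_mul ht).const_mul 4) (by simp [hr, hs])
  have h2 := h1.congr_of_eventuallyEq (f₁ := fun x => z x ^ 2)
    (by filter_upwards [hn] with x hx using h.z_sq_eq hx)
  convert! h2 using 1
  rw [h.z_sq_eq ht]
  simp
  field_simp
  linear_combination (16 * ((r t - s t) * (r t + s t) + 1)) * h.sq_sub_sq ht

theorem hasDerivAt_eval_z_sq (p : ℂ[X]) : HasDerivAt (fun x => p.eval (z x ^ 2))
    ((derivative p).eval (z t ^ 2) * (-1 / (8 * (r t * s t) ^ 3))) t := by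
  have h1 := (p.hasDerivAt (z t ^ 2)).comp t (h.hasDerivAt_z_sq ht)
  exact h1

theorem hasDerivAt_w : HasDerivAt w (-(r t - s t) ^ 2 / (4 * (r t * s t) ^ 2) * w t) t := by
  have hr := h.r_ne_zero ht
  have hs := h.s_ne_zero ht
  have hw := h.w_ne_zero ht
  have hn : Ω ∈ 𝓝 t := h.isOpen.mem_nhds ht
  have h1 : HasDerivAt w (deriv w t) t := (h.w_holo.differentiableAt hn).hasDerivAt
  have h2 : HasDerivAt (fun x => w x ^ 2) (-1 / (8 * (r t * s t) ^ 3)) t :=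
    ((h.hasDerivAt_z_sq ht).add_const 1).congr_of_eventuallyEq
      (by filter_upwards [hn] with x hx using h.w_sq_eq_z_sq_add_one hx)
  have h3 := (h1.pow 2).unique h2
  have h4 : deriv w t = -(r t - s t) ^ 2 / (4 * (r t * s t) ^ 2) * w t := by
    have h5 : 2 * w t ≠ 0 := by simpa using hw
    apply mul_left_cancel₀ h5
    simp at h3
    rw [h3]
    have h6 : 2 * w t * (-(r t - s t) ^ 2 / (4 * (r t * s t) ^ 2) * w t)
      = -(r t - s t) ^ 2 / (2 * (r t * s t) ^ 2) * w t ^ 2 := by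
      field_simp
      ring
    rw [h6, h.w_sq_eq ht]
    field_simp
    linear_combination 8 * ((r t - s t) * (r t + s t) + 1) * h.sq_sub_sq ht
  rwa [h4] at h1

theorem umemuraFun_zero (m : ℕ) (b₁ b₂ : ℂ) : umemuraFun z w 0 m b₁ b₂ t =
    (umemuraPoly (-4 * b₁ ^ 2) (-4 * b₂ ^ 2) m).eval (z t ^ 2) :=
  umemura_zero m _ _ _ _ (h.w_sq_eq_z_sq_add_one ht)

theorem hasDerivAt_umemuraFun (m : ℕ) (b₁ b₂ : ℂ) :
    HasDerivAt (umemuraFun z w 0 m b₁ b₂)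
      ((derivative (umemuraPoly (-4 * b₁ ^ 2) (-4 * b₂ ^ 2) m)).eval (z t ^ 2) *
        (-1 / (8 * (r t * s t) ^ 3))) t := by
  refine (h.hasDerivAt_eval_z_sq ht (umemuraPoly (-4 * b₁ ^ 2) (-4 * b₂ ^ 2) m)).congr_of_eventuallyEq ?_
  filter_upwards [h.isOpen.mem_nhds ht] with x hx using h.umemuraFun_zero hx m b₁ b₂

theorem hFun_zero_eq (m : ℕ) (b₁ b₂ : ℂ) (U : ℂ[X])
    (hU : U = umemuraPoly (-4 * b₁ ^ 2) (-4 * b₂ ^ 2) m) (h0 : U.eval (z t ^ 2) ≠ 0) :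
    hFun r s z w 0 m b₁ b₂ t = r t * s t *
      ((numP (-4 * b₁ ^ 2) (-4 * b₂ ^ 2) U).eval (z t ^ 2) / U.eval (z t ^ 2)) / 4 := by
  have hr := h.r_ne_zero ht
  have hs := h.s_ne_zero ht
  have h16 := h.sixteen_mul ht
  have hz := h.z_sq_eq ht
  have hw := h.w_sq_eq ht
  rw [h.w_sq_eq_z_sq_add_one ht] at hw
  have hzero : hZero r s b₁ b₂ t = r t * s t * (b₁ ^ 2 * z t ^ 2 + b₂ ^ 2 * (z t ^ 2 + 1)) := by
    rw [hw, hz, hZero]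
    field_simp
  rw [hFun, logDeriv_apply, (h.hasDerivAt_umemuraFun ht m b₁ b₂).deriv, h.umemuraFun_zero ht,
    ← hU, h.mul_sub_one ht, hzero, numP]
  simp only [eval_sub, eval_mul, eval_add, eval_C, eval_X, eval_one, eval_ofNat]
  field_simp
  linear_combination (4 * eval (z t ^ 2) (derivative U)) * h16

theorem hasDerivAt_numP_div (a b : ℂ) (U : ℂ[X]) (h0 : U.eval (z t ^ 2) ≠ 0) :
    HasDerivAt (fun x => r x * s x * ((numP a b U).eval (z x ^ 2) / U.eval (z x ^ 2)) / 4)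
      ((numX a b U).eval (z t ^ 2) / U.eval (z t ^ 2) ^ 2 / 4) t := by
  have hr := h.r_ne_zero ht
  have hs := h.s_ne_zero ht
  have hU := h.hasDerivAt_eval_z_sq ht U
  have hN := h.hasDerivAt_eval_z_sq ht (numP a b U)
  have h1 := ((h.hasDerivAt_mul ht).fun_mul (hN.fun_div hU h0)).div_const 4
  convert! h1 using 1
  have h16 := h.sixteen_mul ht
  simp only [numX, eval_sub, eval_mul, eval_add, eval_X, eval_one,
    eval_ofNat]
  field_simp
  linear_combination (-(1 : ℂ)) * (eval (z t ^ 2) (derivative (numP a b U)) * eval (z t ^ 2) U -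
    eval (z t ^ 2) (numP a b U) * eval (z t ^ 2) (derivative U)) * h16

theorem hasDerivAt_numX_div (a b : ℂ) (U : ℂ[X]) (h0 : U.eval (z t ^ 2) ≠ 0) :
    HasDerivAt (fun x => (numX a b U).eval (z x ^ 2) / U.eval (z x ^ 2) ^ 2 / 4)
      (-((numDX a b U).eval (z t ^ 2) / U.eval (z t ^ 2) ^ 3) / (2 * (r t * s t))) t := by
  have hr := h.r_ne_zero ht
  have hs := h.s_ne_zero ht
  have hU := h.hasDerivAt_eval_z_sq ht U
  have hN := h.hasDerivAt_eval_z_sq ht (numX a b U)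
  have h1 := (hN.fun_div (hU.fun_pow 2) (pow_ne_zero 2 h0)).div_const 4
  convert! h1 using 1
  have h16 := h.sixteen_mul ht
  simp only [numDX, eval_sub, eval_mul, eval_add, eval_X, eval_one,
    eval_ofNat]
  push_cast
  field_simp
  linear_combination (-2 : ℂ) * (eval (z t ^ 2) (derivative (numX a b U)) * eval (z t ^ 2) U -
    2 * eval (z t ^ 2) (numX a b U) * eval (z t ^ 2) (derivative U)) * h16

omit ht

/-- A function that agrees with `h_{0,m}(b₁,b₂)` solves the Painlevé-Okamoto equation. -/
theorem solvesEVI_of_eqOn (m : ℕ) (b₁ b₂ : ℂ) {O : Set ℂ} (hO : IsOpen O)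
    (hOΩ : ∀ x ∈ O, x ∈ Ω ∧ umemuraFun z w 0 m b₁ b₂ x ≠ 0) {f : ℂ → ℂ}
    (hf : ∀ x ∈ O, f x = hFun r s z w 0 m b₁ b₂ x) (b : Fin 4 → ℂ) (hb : ∏ k, b k = 0)
    (hpoly : ∀ x, ∏ k, (x + b k ^ 2) =
      x * ((x + b₁ ^ 2) * (x + b₂ ^ 2) * (x + ((m : ℂ) + 1 / 2) ^ 2))) :
    SolvesEVI b f O := by
  set a' : ℂ := -4 * b₁ ^ 2 with ha'
  set b' : ℂ := -4 * b₂ ^ 2 with hb'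
  obtain ⟨U, hU⟩ : ∃ U, U = umemuraPoly a' b' m := ⟨_, rfl⟩
  have h0 : ∀ x ∈ O, U.eval (z x ^ 2) ≠ 0 := fun x hx => by
    have := (hOΩ x hx).2
    rwa [h.umemuraFun_zero (hOΩ x hx).1, ← ha', ← hb', ← hU] at this
  have hf' : ∀ x ∈ O, f x = r x * s x *
      ((numP a' b' U).eval (z x ^ 2) / U.eval (z x ^ 2)) / 4 := fun x hx => by
    rw [hf x hx]
    exact h.hFun_zero_eq (hOΩ x hx).1 m b₁ b₂ U hU (h0 x hx)
  have hd1 : ∀ x ∈ O, HasDerivAt f ((numX a' b' U).eval (z x ^ 2) / U.eval (z x ^ 2) ^ 2 / 4) x :=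
    fun x hx => (h.hasDerivAt_numP_div (hOΩ x hx).1 a' b' U (h0 x hx)).congr_of_eventuallyEq
      (by filter_upwards [hO.mem_nhds hx] with y hy using hf' y hy)
  have hd2 : ∀ x ∈ O, HasDerivAt (deriv f)
      (-((numDX a' b' U).eval (z x ^ 2) / U.eval (z x ^ 2) ^ 3) / (2 * (r x * s x))) x :=
    fun x hx => (h.hasDerivAt_numX_div (hOΩ x hx).1 a' b' U (h0 x hx)).congr_of_eventuallyEq
      (by filter_upwards [hO.mem_nhds hx] with y hy using (hd1 y hy).deriv)
  refine ⟨hO, fun x hx => (hd1 x hx).differentiableAt.differentiableWithinAt, fun x hx => ?_⟩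
  have hx' := (hOΩ x hx).1
  have hr := h.r_ne_zero hx'
  have hs := h.s_ne_zero hx'
  have hU0 := h0 x hx
  have key := congrArg (eval (z x ^ 2)) (umemuraPoly_cubic a' b' m U hU)
  simp only [eval_sub, eval_mul, eval_add, eval_C, eval_X, eval_one, eval_ofNat, eval_pow,
    eval_natCast] at key
  rw [hb, hpoly, (hd1 x hx).deriv, (hd2 x hx).deriv, h.mul_sub_one hx', h.two_mul_sub_one hx',
    hf' x hx]
  have h16 := h.sixteen_mul hx'
  generalize eval (z x ^ 2) (numX a' b' U) = N₁ at *
  generalize eval (z x ^ 2) (numP a' b' U) = N₀ at *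
  generalize eval (z x ^ 2) (numDX a' b' U) = N₂ at *
  generalize eval (z x ^ 2) U = V at *
  -- Now `h = rsP/4`, `h' = X/4` and `2h - (2t-1)h' = rsQ/2`. Since the product of the parameters is
  -- zero, `E_VI` is the cubic relation multiplied by `h'`, up to a constant and a power of `rs`.
  have e1 : (r x * s x) ^ 2 * (-(N₂ / V ^ 3) / (2 * (r x * s x))) = -(r x * s x) / 2 * (N₂ / V ^ 3) := by
    field_simp
  have e2 : 2 * (r x * s x * (N₀ / V) / 4) - (2 * z x ^ 2 + 1) * (2 * (r x * s x)) * (N₁ / V ^ 2 / 4)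
      = (r x * s x) / 2 * ((N₀ * V - (2 * z x ^ 2 + 1) * N₁) / V ^ 2) := by
    field_simp
    ring
  have e3 : ∀ y : ℂ, N₁ / V ^ 2 / 4 + y ^ 2 = (N₁ - (-4 * y ^ 2) * V ^ 2) / (4 * V ^ 2) := by
    intro y
    field_simp
    ring
  rw [e1, e2, e3, e3, e3, ← ha', ← hb']
  have e4 : N₁ - -4 * ((m : ℂ) + 1 / 2) ^ 2 * V ^ 2 = N₁ + (2 * (m : ℂ) + 1) ^ 2 * V ^ 2 := by ring
  rw [e4]
  have e5 : (N₁ - a' * V ^ 2) * (N₁ - b' * V ^ 2) * (N₁ + (2 * (m : ℂ) + 1) ^ 2 * V ^ 2) =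
      4 * (r x * s x) ^ 2 * (4 * N₂ ^ 2 + N₁ * (N₀ * V - (2 * z x ^ 2 + 1) * N₁) ^ 2) := by
    rw [key]
    linear_combination -(N₁ - a' * V ^ 2) * (N₁ - b' * V ^ 2) *
      (N₁ + (2 * (m : ℂ) + 1) ^ 2 * V ^ 2) * h16
  have e6 : (N₁ - a' * V ^ 2) / (4 * V ^ 2) * ((N₁ - b' * V ^ 2) / (4 * V ^ 2)) *
      ((N₁ + (2 * (m : ℂ) + 1) ^ 2 * V ^ 2) / (4 * V ^ 2)) =
      4 * (r x * s x) ^ 2 * (4 * N₂ ^ 2 + N₁ * (N₀ * V - (2 * z x ^ 2 + 1) * N₁) ^ 2) /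
        (64 * V ^ 6) := by
    rw [← e5]
    field_simp
    ring
  rw [e6]
  field_simp
  ring

/-- Removing a factor `C w^{M²}` from a generalized Umemura polynomial. -/
theorem hFun_eq_of_factor {n m μ M : ℕ} {b₂ c : ℂ}
    (hfac : ∀ x ∈ Ω, umemuraFun z w n m 0 b₂ x = c * w x ^ M ^ 2 * umemuraFun z w 0 μ M b₂ x)
    (ht : t ∈ Ω) (h0 : umemuraFun z w n m 0 b₂ t ≠ 0) :
    hFun r s z w n m 0 b₂ t = hFun r s z w 0 μ M b₂ t := by
  have hr := h.r_ne_zero ht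
  have hs := h.s_ne_zero ht
  have hw := h.w_ne_zero ht
  have hV := h.hasDerivAt_umemuraFun ht μ M b₂
  rw [hfac t ht] at h0
  have hc : c ≠ 0 := fun hc => h0 (by simp [hc])
  have hV0 : umemuraFun z w 0 μ M b₂ t ≠ 0 := right_ne_zero_of_mul h0
  have hev : umemuraFun z w n m 0 b₂ =ᶠ[𝓝 t]
      fun x => c * w x ^ M ^ 2 * umemuraFun z w 0 μ M b₂ x := by
    filter_upwards [h.isOpen.mem_nhds ht] with x hx using hfac x hx
  have hwd := (((h.hasDerivAt_w ht).fun_pow (M ^ 2)).const_mul c).differentiableAt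
  have hlog : logDeriv (umemuraFun z w n m 0 b₂) t =
      M ^ 2 * (-(r t - s t) ^ 2 / (4 * (r t * s t) ^ 2)) + logDeriv (umemuraFun z w 0 μ M b₂) t := by
    have h1 : logDeriv (umemuraFun z w n m 0 b₂) t =
        logDeriv (fun x => c * w x ^ M ^ 2 * umemuraFun z w 0 μ M b₂ x) t := by
      rw [logDeriv_apply, logDeriv_apply, hev.deriv_eq, hev.eq_of_nhds]
    have hcw : c * w t ^ M ^ 2 ≠ 0 := mul_ne_zero hc (pow_ne_zero _ hw)
    rw [h1, logDeriv_mul t hcw hV0 hwd hV.differentiableAt, logDeriv_const_mul t c hc,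
      logDeriv_fun_pow (h.hasDerivAt_w ht).differentiableAt, logDeriv_apply w,
      (h.hasDerivAt_w ht).deriv]
    push_cast
    field_simp
  -- The power `w^{M²}` contributes `-M²(r-s)²/4`, exactly minus the `b₁`-term of `h₀` at `b₁ = M`.
  rw [hFun, hFun, hlog, h.mul_sub_one ht, hZero, hZero]
  field_simp
  ring

theorem isOpen_ne_zero (n m : ℕ) (b₁ b₂ : ℂ) :
    IsOpen {t ∈ Ω | umemuraFun z w n m b₁ b₂ t ≠ 0} := by
  have hz := h.z_holo.continuousOn
  have hw := h.w_holo.continuousOn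
  have hc : ContinuousOn (umemuraFun z w n m b₁ b₂) Ω := by
    unfold umemuraFun umemura
    fun_prop
  exact hc.isOpen_inter_preimage h.isOpen isOpen_ne

end AreBranches

end GenUmemura

end

/-! ### Assembly of the three statements. -/

open GenUmemura Polynomial

theorem proposition4 (Ω : Set ℂ) (r s z w : ℂ → ℂ)
    (hbr : GenUmemura.AreBranches Ω r s z w) :
    (∀ (m : ℕ) (b₁ b₂ : ℂ),
      GenUmemura.SolvesEVI ![b₁, b₂, (m : ℂ) + 1 / 2, 0]
        (GenUmemura.hFun r s z w 0 m b₁ b₂)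
        {t ∈ Ω | GenUmemura.umemuraFun z w 0 m b₁ b₂ t ≠ 0}) ∧
    (∀ m : ℕ,
      (∀ t ∈ Ω, GenUmemura.umemuraFun z w 1 m 0 ((m : ℂ) + 1) t ≠ 0 ∧
        GenUmemura.hFun r s z w 1 m 0 ((m : ℂ) + 1) t
          = -(2 * t - 1) * ((m : ℂ) + 1) ^ 2 / 2) ∧
      ∀ b₃ b₄ : ℂ,
        GenUmemura.SolvesEVI ![0, (m : ℂ) + 1, b₃, b₄]
          (GenUmemura.hFun r s z w 1 m 0 ((m : ℂ) + 1)) Ω) ∧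
    (∀ (n m : ℕ) (b₂ : ℂ),
      GenUmemura.SolvesEVI ![0, b₂, (n : ℂ) / 2, ((n : ℂ) + 2 * m + 1) / 2]
        (GenUmemura.hFun r s z w n m 0 b₂)
        {t ∈ Ω | GenUmemura.umemuraFun z w n m 0 b₂ t ≠ 0}) := by
  have heven : ∀ (ν m : ℕ) (b₂ : ℂ), ∃ c : ℂ, ∀ x ∈ Ω, umemuraFun z w (2 * ν) m 0 b₂ x =
      c * w x ^ ν ^ 2 * umemuraFun z w 0 (ν + m) ν b₂ x := by
    intro ν m b₂
    refine ⟨∏ j ∈ Finset.range ν, parityProd (-4 * b₂ ^ 2) (2 * j + 1), fun x hx => ?_⟩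
    rw [hbr.umemuraFun_zero hx, umemuraFun, zero_pow two_ne_zero, mul_zero]
    exact umemura_even ν m _ _ _ (hbr.w_sq_eq_z_sq_add_one hx)
  have hodd : ∀ (ν m : ℕ) (b₂ : ℂ), ∀ x ∈ Ω, umemuraFun z w (2 * ν + 1) m 0 b₂ x =
      (∏ j ∈ Finset.range (ν + m + 1), parityProd (-4 * b₂ ^ 2) (2 * j + 1)) *
        w x ^ (ν + m + 1) ^ 2 * umemuraFun z w 0 ν ((ν + m + 1 : ℕ) : ℂ) b₂ x := by
    intro ν m b₂ x hx
    rw [hbr.umemuraFun_zero hx, umemuraFun, zero_pow two_ne_zero, mul_zero]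
    exact umemura_odd ν m _ _ _ (hbr.w_sq_eq_z_sq_add_one hx)
  refine ⟨fun m b₁ b₂ => ?_, fun m => ?_, fun n m b₂ => ?_⟩
  · refine hbr.solvesEVI_of_eqOn m b₁ b₂ (hbr.isOpen_ne_zero 0 m b₁ b₂) (fun x hx => hx)
      (fun x _ => rfl) _ (by simp [Fin.prod_univ_four]) (fun x => ?_)
    simp [Fin.prod_univ_four]
    ring
  · have hne : ∀ t ∈ Ω, umemuraFun z w 1 m 0 ((m : ℂ) + 1) t ≠ 0 := by
      intro t ht
      have h1 := hodd 0 m ((m : ℂ) + 1) t ht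
      simp only [mul_zero, zero_add] at h1
      rw [h1, hbr.umemuraFun_zero ht, umemuraPoly_zero, eval_one, mul_one]
      refine mul_ne_zero (Finset.prod_ne_zero_iff.mpr fun j hj =>
        Finset.prod_ne_zero_iff.mpr fun i hi => ?_) (pow_ne_zero _ (hbr.w_ne_zero ht))
      have hj' := Finset.mem_range.mp hj
      simp only [Finset.mem_filter, Finset.mem_Icc] at hi
      obtain ⟨k, rfl⟩ : ∃ k, i = k + 1 := ⟨i - 1, by omega⟩
      -- A factor `k² - 4(m+1)²` of `b_i` could vanish only at `k = 2(m+1)`, beyond the range `k ≤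
      -- 2m`.
      have hk : k < 2 * (m + 1) := by omega
      intro h0
      have h2 : ((k ^ 2 : ℕ) : ℂ) = (((2 * (m + 1)) ^ 2 : ℕ) : ℂ) := by
        push_cast at h0 ⊢
        linear_combination h0
      have h3 : k ^ 2 = (2 * (m + 1)) ^ 2 := by exact_mod_cast h2
      exact (Nat.pow_lt_pow_left hk two_ne_zero).ne h3
    have hval : ∀ t ∈ Ω, hFun r s z w 1 m 0 ((m : ℂ) + 1) t
        = -(2 * t - 1) * ((m : ℂ) + 1) ^ 2 / 2 := by
      intro t ht
      have h1 := hbr.hFun_eq_of_factor (hodd 0 m ((m : ℂ) + 1)) ht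
        (by simpa using hne t ht)
      simp only [mul_zero, zero_add] at h1
      rw [h1, hFun, logDeriv_apply, (hbr.hasDerivAt_umemuraFun ht 0 _ _).deriv, umemuraPoly_zero,
        hZero]
      simp
      linear_combination (-((m : ℂ) + 1) ^ 2 / 2) * (hbr.r_sq t ht + hbr.s_sq t ht)
    refine ⟨fun t ht => ⟨hne t ht, hval t ht⟩, fun b₃ b₄ => ?_⟩
    have hd1 : ∀ t ∈ Ω, HasDerivAt (hFun r s z w 1 m 0 ((m : ℂ) + 1)) (-((m : ℂ) + 1) ^ 2) t := by
      intro t ht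
      have h1 : HasDerivAt (fun t : ℂ => -(2 * t - 1) * ((m : ℂ) + 1) ^ 2 / 2)
          (-((m : ℂ) + 1) ^ 2) t := by
        convert! (((((hasDerivAt_id t).const_mul 2).sub_const 1).neg).mul_const
          (((m : ℂ) + 1) ^ 2)).div_const 2 using 1
        ring
      exact h1.congr_of_eventuallyEq
        (by filter_upwards [hbr.isOpen.mem_nhds ht] with x hx using hval x hx)
    have hd2 : ∀ t ∈ Ω, deriv (deriv (hFun r s z w 1 m 0 ((m : ℂ) + 1))) t = 0 := by
      intro t ht
      have h1 : deriv (hFun r s z w 1 m 0 ((m : ℂ) + 1)) =ᶠ[nhds t]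
          fun _ => -((m : ℂ) + 1) ^ 2 := by
        filter_upwards [hbr.isOpen.mem_nhds ht] with x hx using (hd1 x hx).deriv
      rw [h1.deriv_eq, deriv_const]
    refine ⟨hbr.isOpen, fun t ht => (hd1 t ht).differentiableAt.differentiableWithinAt,
      fun t ht => ?_⟩
    -- Both sides vanish: `b₁ = 0`, `h'' = 0` and `2h = (2t-1)h'` on the left, `h' + b₂² = 0` on the
    -- right.
    rw [hd2 t ht, (hd1 t ht).deriv, hval t ht]
    simp [Fin.prod_univ_four]
    right
    ring
  · have hopen := hbr.isOpen_ne_zero n m 0 b₂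
    -- For `n = 2ν` the pair `(M, μ + 1/2)` is `(n/2, (n+2m+1)/2)`; for odd `n` the two entries are
    -- exchanged, which is harmless since the product of the parameters is zero and the right side
    -- is symmetric.
    rcases Nat.even_or_odd' n with ⟨ν, rfl | rfl⟩
    · obtain ⟨c, hc⟩ := heven ν m b₂
      refine hbr.solvesEVI_of_eqOn (ν + m) ν b₂ hopen
        (fun x hx => ⟨hx.1, fun h0 => hx.2 (by rw [hc x hx.1, h0, mul_zero])⟩)
        (fun x hx => hbr.hFun_eq_of_factor hc hx.1 hx.2) _ (by simp [Fin.prod_univ_four])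
        (fun x => ?_)
      simp [Fin.prod_univ_four]
      ring
    · have hc := hodd ν m b₂
      refine hbr.solvesEVI_of_eqOn ν ((ν + m + 1 : ℕ) : ℂ) b₂ hopen
        (fun x hx => ⟨hx.1, fun h0 => hx.2 (by rw [hc x hx.1, h0, mul_zero])⟩)
        (fun x hx => hbr.hFun_eq_of_factor hc hx.1 hx.2) _ (by simp [Fin.prod_univ_four])
        (fun x => ?_)
      simp [Fin.prod_univ_four]
      ring
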